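/- Let $W=(W_t)_{t\ge 0}$ be a standard Wiener process on a probability space $(\Omega,\mathcal F,\mathbf P)$, let $\sigma>0$, and for $0<v\le 1$ put $$\tilde\eta_v=\int_0^v e^{\sigma W_u-\sigma^2u/2}\,du .$$ For $0<v\le1$ and $a\in\mathbb R$ let $$F(v,a)=\int_0^v e^{\sigma W_u-\sigma uW_1-\sigma^2u/2+\sigma ua}\,du,\qquad K(v,a)=\frac{\partial F}{\partial a}(v,a)=\sigma\int_0^v u\,e^{\sigma W_u-\sigma uW_1-\sigma^2u/2+\sigma ua}\,du,$$ for $z>0$ let $a(v,z)$ be the (random) solution of $F(v,a(v,z))=z$, and let $$q(v,z)=\mathbf E\,\frac{\varphi(a(v,z))}{K(v,a(v,z))},\qquad \varphi(x)=\frac1{\sqrt{2\pi}}e^{-x^2/2}.$$ Then for every $\sigma_0>0$ there are constants $\tilde c>0$ and $\kappa>0$, depending only on $\sigma_0$, such that for all $\sigma\ge\sigma_0$ and all $0<v\le1$ the following holds. The expectation defining $q(v,z)$ is finite for every $z>0$, and $q(v,\cdot)$ is the density of $\tilde\eta_v$ on $(0,\infty)$. Moreover, for every $z>0$ the derivative $q_v(v,z)$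 of $q(\cdot,z)$ at $v$ exists (the left derivative if $v=1$), and $$|q_v(v,z)|\le\frac{\tilde c\,\sigma^7}{v_*^4}\left(\mathbf 1_{\{z\le v\}}+\exp\left\{-\frac{\kappa}{\sigma^2v}\Big(\ln\frac zv\Big)^2\right\}\mathbf 1_{\{z>v\}}\right),\qquad v_*=\min(\sigma^2v,1).$$ -/

import Mathlib

open MeasureTheory ProbabilityTheory
open scoped NNReal

noncomputable section

namespace AsianDensity

/-- `exp {σ w_u - σ u w_1 - σ² u / 2 + σ u a}`: the exponential functional at time `u` along the
path obtained from `w` by replacing its value at time `1` by `a` (bridge from `0` to `a`). -/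
def bridgeExp (σ : ℝ) (w : ℝ≥0 → ℝ) (u a : ℝ) : ℝ :=
  Real.exp (σ * w u.toNNReal - σ * u * w 1 - σ ^ 2 * u / 2 + σ * u * a)

/-- `F(v,a) = ∫₀^v exp {σ w_u - σ u w_1 - σ² u / 2 + σ u a} du`. -/
def F (σ : ℝ) (w : ℝ≥0 → ℝ) (v a : ℝ) : ℝ :=
  ∫ u in (0 : ℝ)..v, bridgeExp σ w u a

/-- `K(v,a) = ∂F/∂a (v,a) = σ ∫₀^v u exp {σ w_u - σ u w_1 - σ² u / 2 + σ u a} du`. -/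
def K (σ : ℝ) (w : ℝ≥0 → ℝ) (v a : ℝ) : ℝ :=
  σ * ∫ u in (0 : ℝ)..v, u * bridgeExp σ w u a

/-- The function `a(v,z)` given implicitly by `z = F(v, a(v,z))`. For a continuous path, `σ > 0`
and `v > 0`, the map `F(v,·)` is a strictly increasing bijection from `ℝ` onto `(0,∞)`, so that the
solution exists and is unique for every `z > 0`. -/
def a (σ : ℝ) (w : ℝ≥0 → ℝ) (v z : ℝ) : ℝ :=
  Function.invFun (F σ w v) z

/-- `φ(a(v,z)) / K(v, a(v,z))`, where `φ` is the standard Gaussian density. -/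
def densityIntegrand (σ : ℝ) (w : ℝ≥0 → ℝ) (v z : ℝ) : ℝ :=
  gaussianPDFReal 0 1 (a σ w v z) / K σ w v (a σ w v z)

/-- `q(v,z) = E [φ(a(v,z)) / K(v, a(v,z))]`. -/
def q {Ω : Type*} [MeasurableSpace Ω] (P : Measure Ω) (W : ℝ≥0 → Ω → ℝ) (σ v z : ℝ) : ℝ :=
  ∫ ω, densityIntegrand σ (fun t => W t ω) v z ∂P

/-- The random variable `η_v = ∫₀^v exp {σ W_u - σ² u / 2} du`. -/
def eta {Ω : Type*} (W : ℝ≥0 → Ω → ℝ) (σ v : ℝ) (ω : Ω) : ℝ :=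
  ∫ u in (0 : ℝ)..v, Real.exp (σ * W u.toNNReal ω - σ ^ 2 * u / 2)

end AsianDensity

end

namespace AsianDensity

open Filter Topology

/-! ### Pathwise calculus of the functionals $F$, $K$ and the implicit function $a(v,z)$ -/

section Paths

variable {σ : ℝ} {w : ℝ≥0 → ℝ}

/-! The bridge $W_u-uW_1$ is independent of $W_1$, and $\tilde\eta_v=F(v,W_1)$ with $F$ depending on
the path through the bridge only. With the bridge frozen, $F(v,\cdot)$ is an increasing
diffeomorphism of $\mathbb R$ onto $(0,\infty)$ with derivative $K$, so the change of variables
$z=F(v,x)$ under the Gaussian law of $W_1$ gives the density $\varphi(a)/K$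
(`lintegral_gaussian_comp_F`). Averaging over the bridge gives $q$ (`map_eta_eq_withDensity`).

For a fixed path the implicit function theorem gives $a_v=-G/K$, where $G$ is the exponential at
time $v$, so the $v$-derivative of $\varphi(a)/K$ is explicit (`hasDerivAt_densityIntegrand`). It is
$\varphi(a)\cdot(G/K)\cdot(1/K)$ times a bracket of size at most $|a|+\sigma v$. The factor $1/K$ is
bounded by keeping only $[0,\delta]$ in the integral $K$, and $G/K$ by keeping only $[v-\delta,v]$.
With $\delta=v_*/(2\sigma^2)$, $\sigma W$ oscillates by order one on such intervals, and $\delta$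
produces the factor $\sigma^7/v_*^4$ (`abs_densityDeriv_le_derivConst`).

For the tail, $z=F(v,a)\le v\exp(\sigma\sup|\text{bridge}|+\sigma v|a|)$, so a large $\ln(z/v)$
forces the path or $a$ to be large (`tailExponent_le`). A large $a$ is paid for by $\varphi(a)$. A
large path is paid for by a dyadic chaining bound $\sup_{[0,t]}W^2\le 256\,t\log A$ with $\mathbf E
A\le 4e^4$ (`exists_sq_le_log`): quadratic path terms in an exponent become powers of $A$, and all
estimates are arranged so that the total power is at most one. -/

lemma bridgeExp_pos (σ : ℝ) (w : ℝ≥0 → ℝ) (u a : ℝ) : 0 < bridgeExp σ w u a := Real.exp_pos _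

lemma continuous_bridgeExp (hw : Continuous w) :
    Continuous (fun p : ℝ × ℝ => bridgeExp σ w p.1 p.2) := by
  unfold bridgeExp
  have : Continuous (fun p : ℝ × ℝ => w p.1.toNNReal) :=
    hw.comp (continuous_real_toNNReal.comp continuous_fst)
  fun_prop

lemma continuous_bridgeExp_left (hw : Continuous w) (a : ℝ) :
    Continuous (fun u => bridgeExp σ w u a) :=
  (continuous_bridgeExp hw).comp (by fun_prop : Continuous fun u : ℝ => (u, a))

/-- The weighted moments `∫₀^v u^k bridgeExp u a du`. -/
noncomputable def moment (σ : ℝ) (w : ℝ≥0 → ℝ) (k : ℕ) (v a : ℝ) : ℝ :=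
  ∫ u in (0 : ℝ)..v, u ^ k * bridgeExp σ w u a

lemma F_eq_moment (v a : ℝ) : F σ w v a = moment σ w 0 v a := by simp [F, moment]

lemma K_eq_moment (v a : ℝ) : K σ w v a = σ * moment σ w 1 v a := by simp [K, moment]

lemma continuous_moment_integrand (hw : Continuous w) (k : ℕ) (a : ℝ) :
    Continuous (fun u => u ^ k * bridgeExp σ w u a) :=
  (continuous_pow k).mul (continuous_bridgeExp_left hw a)

lemma intervalIntegrable_moment (hw : Continuous w) (k : ℕ) (a s t : ℝ) :
    IntervalIntegrable (fun u => u ^ k * bridgeExp σ w u a) volume s t :=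
  (continuous_moment_integrand hw k a).intervalIntegrable s t

lemma continuous_moment (hw : Continuous w) (k : ℕ) :
    Continuous (fun p : ℝ × ℝ => moment σ w k p.1 p.2) := by
  unfold moment
  refine intervalIntegral.continuous_parametric_intervalIntegral_of_continuous
    (f := fun (p : ℝ × ℝ) u => u ^ k * bridgeExp σ w u p.2) ?_ continuous_fst
  have h := (continuous_bridgeExp (σ := σ) hw).comp
    (by fun_prop : Continuous fun q : (ℝ × ℝ) × ℝ => (q.2, q.1.2))
  exact (by fun_prop : Continuous fun q : (ℝ × ℝ) × ℝ => q.2 ^ k).mul h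

lemma hasDerivAt_moment_left (hw : Continuous w) (k : ℕ) (v a : ℝ) :
    HasDerivAt (fun x => moment σ w k x a) (v ^ k * bridgeExp σ w v a) v :=
  ((continuous_moment_integrand hw k a).integral_hasStrictDerivAt 0 v).hasDerivAt

lemma hasDerivAt_moment_right (hw : Continuous w) (k : ℕ) (v a : ℝ) :
    HasDerivAt (fun x => moment σ w k v x) (σ * moment σ w (k + 1) v a) a := by
  have key := intervalIntegral.hasDerivAt_integral_of_dominated_loc_of_deriv_le
    (μ := volume) (a := 0) (b := v) (x₀ := a) (s := Metric.ball a 1)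
    (F := fun x u => u ^ k * bridgeExp σ w u x)
    (F' := fun x u => σ * (u ^ (k + 1) * bridgeExp σ w u x))
    (bound := fun u => |σ| * (|u| ^ (k + 1) *
      Real.exp (σ * w u.toNNReal - σ * u * w 1 - σ ^ 2 * u / 2 + |σ * u| * (|a| + 1))))
    (Metric.ball_mem_nhds a one_pos)
    (Eventually.of_forall fun x => (continuous_moment_integrand hw k x).aestronglyMeasurable)
    (intervalIntegrable_moment hw k a 0 v)
    (continuous_const.mul (continuous_moment_integrand hw (k+1) a)).aestronglyMeasurable
    (Eventually.of_forall fun u _ x hx => ?_) ?_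
    (Eventually.of_forall fun u _ x hx => ?_)
  · have h2 := key.2
    rw [intervalIntegral.integral_const_mul] at h2
    exact h2
  · rw [Real.norm_eq_abs, abs_mul, abs_mul, abs_pow, abs_of_pos (bridgeExp_pos _ _ _ _)]
    gcongr
    rw [Metric.mem_ball, Real.dist_eq] at hx
    have h1 := abs_sub_abs_le_abs_sub x a
    have h2 : σ * u * x ≤ |σ * u| * (|a| + 1) := by
      refine (le_abs_self _).trans ?_
      rw [abs_mul]
      gcongr
      linarith
    refine Real.exp_le_exp.2 ?_
    linarith
  · apply Continuous.intervalIntegrable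
    have : Continuous (fun u : ℝ => w u.toNNReal) := hw.comp continuous_real_toNNReal
    fun_prop
  · unfold bridgeExp
    have h1 : HasDerivAt (fun x : ℝ =>
        σ * w u.toNNReal - σ * u * w 1 - σ ^ 2 * u / 2 + σ * u * x) (σ * u) x := by
      simpa using ((hasDerivAt_id x).const_mul (σ * u)).const_add
        (σ * w u.toNNReal - σ * u * w 1 - σ ^ 2 * u / 2)
    refine (h1.exp.const_mul (u ^ k)).congr_deriv ?_
    ring

/-- Both partial derivatives are jointly continuous. Strict joint differentiability is what the
implicit function theorem needs; it also gives the chain rule along $v\mapsto(v,a(v,z))$. -/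
lemma hasStrictFDerivAt_moment (hw : Continuous w) (k : ℕ) (p : ℝ × ℝ) :
    HasStrictFDerivAt (fun p : ℝ × ℝ => moment σ w k p.1 p.2)
      ((ContinuousLinearMap.toSpanSingleton ℝ (p.1 ^ k * bridgeExp σ w p.1 p.2)).coprod
        (ContinuousLinearMap.toSpanSingleton ℝ (σ * moment σ w (k + 1) p.1 p.2))) p := by
  have hc : Continuous (ContinuousLinearMap.toSpanSingleton ℝ : ℝ → ℝ →L[ℝ] ℝ) :=
    (ContinuousLinearMap.toSpanSingletonCLE (𝕜 := ℝ) (E := ℝ)).continuous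
  refine hasStrictFDerivAt_uncurry_coprod (𝕜 := ℝ) (u := p)
    (f := fun v a => moment σ w k v a)
    (f₁ := fun v a => ContinuousLinearMap.toSpanSingleton ℝ (v ^ k * bridgeExp σ w v a))
    (f₂ := fun v a => ContinuousLinearMap.toSpanSingleton ℝ (σ * moment σ w (k + 1) v a))
    (Eventually.of_forall fun q => (hasDerivAt_moment_left hw k q.1 q.2).hasFDerivAt)
    (Eventually.of_forall fun q => (hasDerivAt_moment_right hw k q.1 q.2).hasFDerivAt) ?_ ?_
  · exact (hc.comp ((continuous_fst.pow k).mul (continuous_bridgeExp hw))).continuousAt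
  · exact (hc.comp (continuous_const.mul (continuous_moment hw (k + 1)))).continuousAt

lemma hasDerivAt_moment_comp (hw : Continuous w) (k : ℕ) {α : ℝ → ℝ} {α' v : ℝ}
    (hα : HasDerivAt α α' v) :
    HasDerivAt (fun x => moment σ w k x (α x))
      (v ^ k * bridgeExp σ w v (α v) + σ * moment σ w (k + 1) v (α v) * α') v := by
  have h := (hasStrictFDerivAt_moment (σ := σ) hw k (v, α v)).hasFDerivAt.comp_hasDerivAt v
    ((hasDerivAt_id v).prodMk hα)
  refine h.congr_deriv ?_
  simp [mul_comm]

lemma moment_pos (hw : Continuous w) (k : ℕ) {v : ℝ} (hv : 0 < v) (a : ℝ) :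
    0 < moment σ w k v a :=
  intervalIntegral.intervalIntegral_pos_of_pos_on (intervalIntegrable_moment hw k a 0 v)
    (fun u hu => mul_pos (pow_pos hu.1 k) (bridgeExp_pos σ w u a)) hv

lemma moment_nonneg (k : ℕ) {v : ℝ} (hv : 0 ≤ v) (a : ℝ) : 0 ≤ moment σ w k v a :=
  intervalIntegral.integral_nonneg hv fun u hu =>
    mul_nonneg (pow_nonneg hu.1 k) (bridgeExp_pos σ w u a).le

lemma moment_succ_le (hw : Continuous w) (k : ℕ) {v : ℝ} (hv : 0 ≤ v) (a : ℝ) :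
    moment σ w (k + 1) v a ≤ v * moment σ w k v a := by
  unfold moment
  rw [← intervalIntegral.integral_const_mul]
  refine intervalIntegral.integral_mono_on hv (intervalIntegrable_moment hw _ a 0 v)
    ((intervalIntegrable_moment hw _ a 0 v).const_mul v) fun u hu => ?_
  rw [pow_succ', mul_assoc]
  exact mul_le_mul_of_nonneg_right hu.2
    (mul_nonneg (pow_nonneg hu.1 k) (bridgeExp_pos σ w u a).le)

lemma K_pos (hσ : 0 < σ) (hw : Continuous w) {v : ℝ} (hv : 0 < v) (a : ℝ) : 0 < K σ w v a := by
  rw [K_eq_moment]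
  exact mul_pos hσ (moment_pos hw 1 hv a)

lemma hasDerivAt_F (hw : Continuous w) (v a : ℝ) :
    HasDerivAt (fun x => F σ w v x) (K σ w v a) a := by
  simp only [F_eq_moment, K_eq_moment]
  exact hasDerivAt_moment_right hw 0 v a

lemma strictMono_F (hσ : 0 < σ) (hw : Continuous w) {v : ℝ} (hv : 0 < v) :
    StrictMono (F σ w v) :=
  strictMono_of_hasDerivAt_pos (fun a => hasDerivAt_F hw v a) (fun a => K_pos hσ hw hv a)

lemma F_pos (hw : Continuous w) {v : ℝ} (hv : 0 < v) (a : ℝ) : 0 < F σ w v a := by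
  rw [F_eq_moment]
  exact moment_pos hw 0 hv a

lemma tendsto_F_atTop (hσ : 0 < σ) (hw : Continuous w) {v : ℝ} (hv : 0 < v) :
    Tendsto (F σ w v) atTop atTop := by
  -- By $e^t\ge 1+t$, $F(v,\cdot)$ lies above its tangent at $0$, whose slope $K(v,0)$ is positive.
  have h1 : ∀ a, F σ w v 0 + K σ w v 0 * a ≤ F σ w v a := by
    intro a
    rw [F_eq_moment, F_eq_moment, K_eq_moment]
    unfold moment
    rw [mul_comm, ← intervalIntegral.integral_const_mul, ← intervalIntegral.integral_const_mul,
      ← intervalIntegral.integral_add (intervalIntegrable_moment hw _ _ 0 v)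
        (((intervalIntegrable_moment hw _ _ 0 v).const_mul _).const_mul _)]
    refine intervalIntegral.integral_mono_on hv.le
      ((intervalIntegrable_moment hw _ _ 0 v).add
        (((intervalIntegrable_moment hw _ _ 0 v).const_mul _).const_mul _))
      (intervalIntegrable_moment hw _ _ 0 v) fun u _ => ?_
    have h2 : bridgeExp σ w u a = bridgeExp σ w u 0 * Real.exp (σ * u * a) := by
      unfold bridgeExp
      rw [← Real.exp_add]
      ring_nf
    have h3 := Real.add_one_le_exp (σ * u * a)
    have h4 := mul_le_mul_of_nonneg_left h3 (bridgeExp_pos σ w u 0).le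
    rw [h2]
    linarith
  refine tendsto_atTop_mono h1 ?_
  exact tendsto_atTop_add_const_left _ _ (tendsto_id.const_mul_atTop (K_pos hσ hw hv 0))

lemma tendsto_F_atBot (hσ : 0 < σ) (hw : Continuous w) {v : ℝ} (hv : 0 < v) :
    Tendsto (F σ w v) atBot (𝓝 0) := by
  have h := intervalIntegral.tendsto_integral_filter_of_dominated_convergence
    (μ := volume) (a := 0) (b := v) (l := atBot)
    (F := fun a u => bridgeExp σ w u a) (f := fun _ => 0) (fun u => bridgeExp σ w u 0)
    (Eventually.of_forall fun x => (continuous_bridgeExp_left hw x).aestronglyMeasurable)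
    ?_ ((continuous_bridgeExp_left hw 0).intervalIntegrable _ _)
    (Eventually.of_forall fun u hu => ?_)
  · unfold F
    simpa using h
  · filter_upwards [eventually_le_atBot 0] with x hx
    refine Eventually.of_forall fun u hu => ?_
    rw [Set.uIoc_of_le hv.le] at hu
    rw [Real.norm_eq_abs, abs_of_pos (bridgeExp_pos _ _ _ _)]
    unfold bridgeExp
    have := mul_nonneg hσ.le hu.1.le
    gcongr
  · rw [Set.uIoc_of_le hv.le] at hu
    unfold bridgeExp
    refine Real.tendsto_exp_atBot.comp ?_
    exact tendsto_atBot_add_const_left _ _ (tendsto_id.const_mul_atBot (mul_pos hσ hu.1))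

lemma range_F (hσ : 0 < σ) (hw : Continuous w) {v : ℝ} (hv : 0 < v) :
    Set.range (F σ w v) = Set.Ioi 0 := by
  apply Set.Subset.antisymm
  · rintro _ ⟨a, rfl⟩
    exact F_pos hw hv a
  · intro z hz
    have hc : Continuous (F σ w v) :=
      continuous_iff_continuousAt.2 fun a => (hasDerivAt_F hw v a).continuousAt
    obtain ⟨x, hx⟩ := ((tendsto_F_atBot hσ hw hv).eventually (gt_mem_nhds hz)).exists
    obtain ⟨y, hy⟩ := ((tendsto_F_atTop hσ hw hv).eventually (eventually_ge_atTop z)).exists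
    exact mem_range_of_exists_le_of_exists_ge hc ⟨x, le_of_lt hx⟩ ⟨y, hy⟩

lemma F_a (hσ : 0 < σ) (hw : Continuous w) {v z : ℝ} (hv : 0 < v) (hz : 0 < z) :
    F σ w v (a σ w v z) = z := by
  have : z ∈ Set.range (F σ w v) := by rw [range_F hσ hw hv]; exact hz
  exact Function.invFun_eq this

lemma a_F (hσ : 0 < σ) (hw : Continuous w) {v : ℝ} (hv : 0 < v) (x : ℝ) :
    a σ w v (F σ w v x) = x :=
  Function.leftInverse_invFun (strictMono_F hσ hw hv).injective x

lemma hasDerivAt_a (hσ : 0 < σ) (hw : Continuous w) {v z : ℝ} (hv : 0 < v) (hz : 0 < z) :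
    HasDerivAt (fun x => a σ w x z)
      (-(bridgeExp σ w v (a σ w v z) / K σ w v (a σ w v z))) v := by
  have hs := hasStrictFDerivAt_moment (σ := σ) hw 0 (v, a σ w v z)
  have hK := (K_pos hσ hw hv (a σ w v z)).ne'
  rw [K_eq_moment] at *
  set G := bridgeExp σ w v (a σ w v z)
  set c := σ * moment σ w 1 v (a σ w v z)
  have hcomp : ((ContinuousLinearMap.toSpanSingleton ℝ (v ^ 0 * G)).coprod
      (ContinuousLinearMap.toSpanSingleton ℝ c)) ∘L .inr ℝ ℝ ℝ =
      (ContinuousLinearEquiv.unitsEquivAut ℝ (Units.mk0 c hK) : ℝ →L[ℝ] ℝ) := by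
    ext
    simp
  have hinv : (((ContinuousLinearMap.toSpanSingleton ℝ (v ^ 0 * G)).coprod
      (ContinuousLinearMap.toSpanSingleton ℝ c)) ∘L .inr ℝ ℝ ℝ).IsInvertible :=
    ⟨_, hcomp.symm⟩
  have h1 := (hs.hasStrictFDerivAt_implicitFunctionOfProdDomain hinv).hasFDerivAt.hasDerivAt
  have h2 := hs.eventually_apply_implicitFunctionOfProdDomain hinv
  -- Injectivity of $F(x,\cdot)$ identifies the local implicit function with the globally defined
  -- `a`.
  have h3 : (fun x => a σ w x z) =ᶠ[𝓝 v] hs.implicitFunctionOfProdDomain hinv := by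
    filter_upwards [h2, lt_mem_nhds hv] with x hx hx0
    have h4 : F σ w x (hs.implicitFunctionOfProdDomain hinv x) = z := by
      rw [F_eq_moment]
      refine hx.trans ?_
      rw [← F_eq_moment, F_a hσ hw hv hz]
    have h5 := a_F hσ hw hx0 (hs.implicitFunctionOfProdDomain hinv x)
    rwa [h4] at h5
  refine (h1.congr_of_eventuallyEq h3).congr_deriv ?_
  rw [hcomp, ContinuousLinearMap.inverse_equiv]
  simp [ContinuousLinearEquiv.unitsEquivAut, div_eq_mul_inv]

/-- The derivative of `v ↦ φ(a(v,z)) / K(v, a(v,z))`. -/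
noncomputable def densityDeriv (σ : ℝ) (w : ℝ≥0 → ℝ) (v z : ℝ) : ℝ :=
  gaussianPDFReal 0 1 (a σ w v z) * bridgeExp σ w v (a σ w v z) / K σ w v (a σ w v z) ^ 2 *
    (a σ w v z - σ * v + σ ^ 2 * moment σ w 2 v (a σ w v z) / K σ w v (a σ w v z))

lemma hasDerivAt_gaussianPDFReal (x : ℝ) :
    HasDerivAt (gaussianPDFReal 0 1) (-x * gaussianPDFReal 0 1 x) x := by
  unfold gaussianPDFReal
  have h : HasDerivAt (fun x : ℝ => -(x - 0) ^ 2 / (2 * ((1 : ℝ≥0) : ℝ))) (-x) x := by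
    have := (((hasDerivAt_id x).pow 2).neg.div_const 2)
    simp only [NNReal.coe_one, mul_one, sub_zero]
    refine this.congr_deriv ?_
    simp
    ring
  refine (h.exp.const_mul _).congr_deriv ?_
  ring

lemma hasDerivAt_densityIntegrand (hσ : 0 < σ) (hw : Continuous w) {v z : ℝ} (hv : 0 < v)
    (hz : 0 < z) :
    HasDerivAt (fun x => densityIntegrand σ w x z) (densityDeriv σ w v z) v := by
  have ha := hasDerivAt_a hσ hw hv hz
  have hK := (K_pos hσ hw hv (a σ w v z)).ne'
  have hm := (hasDerivAt_moment_comp (σ := σ) hw 1 ha).const_mul σ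
  have hφ := (hasDerivAt_gaussianPDFReal (a σ w v z)).comp v ha
  have h := hφ.div hm (by rw [← K_eq_moment]; exact hK)
  simp only [← K_eq_moment] at h
  refine h.congr_deriv ?_
  unfold densityDeriv
  have e : σ * (v ^ 1 * bridgeExp σ w v (a σ w v z) + σ * moment σ w (1 + 1) v (a σ w v z) *
      -(bridgeExp σ w v (a σ w v z) / K σ w v (a σ w v z))) = σ * v * bridgeExp σ w v (a σ w v z)
      - σ ^ 2 * moment σ w 2 v (a σ w v z) * (bridgeExp σ w v (a σ w v z) / K σ w v (a σ w v z)) := by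
    ring_nf
  simp only [Function.comp_apply]
  rw [e]
  field_simp
  ring

end Paths

/-! ### Pathwise bounds for the integrand and its derivative; joint measurability -/

section Estimates

variable {σ : ℝ} {w : ℝ≥0 → ℝ}

lemma bridgeExp_eq (u a : ℝ) :
    bridgeExp σ w u a =
      Real.exp (σ * (w u.toNNReal - u * w 1) - σ ^ 2 * u / 2 + σ * u * a) := by
  unfold bridgeExp
  ring_nf

lemma integral_mono_subinterval {f : ℝ → ℝ} (hf : Continuous f) {s t v : ℝ} (hs : 0 ≤ s)
    (hst : s ≤ t) (htv : t ≤ v) (h0 : ∀ u, 0 ≤ u → 0 ≤ f u) :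
    ∫ u in s..t, f u ≤ ∫ u in (0 : ℝ)..v, f u :=
  intervalIntegral.integral_mono_interval hs hst htv
    ((ae_restrict_iff' measurableSet_Ioc).2 (Eventually.of_forall fun u hu => h0 u hu.1.le))
    (hf.intervalIntegrable _ _)

/-- Only $[0,\delta]$ is kept in the integral, so that $|a|$ enters with the small factor
$\sigma\delta$ instead of $\sigma v$. -/
lemma inv_K_le (hσ : 0 < σ) (hw : Continuous w) {v δ m : ℝ} (hδ : 0 < δ) (hδv : δ ≤ v)
    (hm : ∀ u ∈ Set.Icc 0 δ, |w u.toNNReal - u * w 1| ≤ m) (a : ℝ) :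
    (K σ w v a)⁻¹ ≤ 2 / (σ * δ ^ 2) * Real.exp (σ * m + σ ^ 2 * δ / 2 + σ * δ * |a|) := by
  set E := σ * m + σ ^ 2 * δ / 2 + σ * δ * |a| with hE
  have h1 : ∫ u in (0 : ℝ)..δ, u * Real.exp (-E) ≤ moment σ w 1 v a := by
    have hc := continuous_moment_integrand (σ := σ) hw 1 a
    refine le_trans ?_ (integral_mono_subinterval hc le_rfl hδ.le hδv fun u hu =>
      mul_nonneg (pow_nonneg hu 1) (bridgeExp_pos σ w u a).le)
    refine intervalIntegral.integral_mono_on hδ.le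
      ((continuous_id.mul continuous_const).intervalIntegrable _ _)
      (hc.intervalIntegrable _ _) fun u hu => ?_
    rw [pow_one, bridgeExp_eq]
    refine mul_le_mul_of_nonneg_left (Real.exp_le_exp.2 ?_) hu.1
    have h2 := mul_le_mul_of_nonneg_left (abs_le.1 (hm u hu)).1 hσ.le
    have h3 : σ ^ 2 * u / 2 ≤ σ ^ 2 * δ / 2 := by have := hu.2; gcongr
    have h4 : σ * u * -a ≤ σ * δ * |a| := by
      have := neg_le_abs a
      have := hu.1
      have := hu.2
      calc σ * u * -a ≤ σ * u * |a| := by gcongr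
        _ ≤ _ := by gcongr
    rw [hE]
    linarith
  have h2 : ∫ u in (0 : ℝ)..δ, u * Real.exp (-E) = δ ^ 2 / 2 * Real.exp (-E) := by
    rw [intervalIntegral.integral_mul_const, integral_id]
    ring
  rw [h2] at h1
  have h3 : (2 / (σ * δ ^ 2) * Real.exp E)⁻¹ ≤ K σ w v a := by
    rw [K_eq_moment, mul_inv, ← Real.exp_neg, inv_div]
    calc σ * δ ^ 2 / 2 * Real.exp (-E) = σ * (δ ^ 2 / 2 * Real.exp (-E)) := by ring
      _ ≤ _ := by gcongr
  exact inv_le_of_inv_le₀ (by positivity) h3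

/-- On $[v-\delta,v]$ the integrand of $K$ is comparable with its endpoint value, and the weight $u$
is at least $v/2$. Only the increment of the bridge over this interval matters, not its size. -/
lemma bridgeExp_div_K_le (hσ : 0 < σ) (hw : Continuous w) {v δ m : ℝ} (hδ : 0 < δ)
    (hδv : δ ≤ v / 2)
    (hm : ∀ u ∈ Set.Icc (v - δ) v,
      |(w v.toNNReal - v * w 1) - (w u.toNNReal - u * w 1)| ≤ m) (a : ℝ) :
    bridgeExp σ w v a / K σ w v a ≤
      2 / (σ * v * δ) * Real.exp (σ * m + σ * δ * |a|) := by
  set E := σ * m + σ * δ * |a| with hE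
  set G := bridgeExp σ w v a with hG
  have hv : 0 < v := by linarith
  have hGpos : 0 < G := bridgeExp_pos _ _ _ _
  have h1 : ∫ _ in (v - δ)..v, (v / 2 * (G * Real.exp (-E))) ≤ moment σ w 1 v a := by
    have hc := continuous_moment_integrand (σ := σ) hw 1 a
    refine le_trans ?_ (integral_mono_subinterval hc (by linarith : 0 ≤ v - δ) (by linarith)
      le_rfl fun u hu => mul_nonneg (pow_nonneg hu 1) (bridgeExp_pos σ w u a).le)
    refine intervalIntegral.integral_mono_on (by linarith)
      (continuous_const.intervalIntegrable _ _)
      (hc.intervalIntegrable _ _) fun u hu => ?_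
    have hu1 := hu.1
    have hu2 := hu.2
    rw [pow_one]
    refine mul_le_mul (by linarith) ?_ (by positivity) (by linarith)
    rw [hG, bridgeExp_eq, bridgeExp_eq, ← Real.exp_add]
    refine Real.exp_le_exp.2 ?_
    have h2 := mul_le_mul_of_nonneg_left (abs_le.1 (hm u hu)).2 hσ.le
    have h3 : σ ^ 2 * u / 2 ≤ σ ^ 2 * v / 2 := by gcongr
    have h4 : σ * (v - u) * a ≤ σ * δ * |a| := by
      have := le_abs_self a
      have : 0 ≤ v - u := by linarith
      calc σ * (v - u) * a ≤ σ * (v - u) * |a| := by gcongr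
        _ ≤ _ := by gcongr; linarith
    rw [hE]
    linarith
  have hK := K_pos hσ hw hv a
  rw [intervalIntegral.integral_const, smul_eq_mul, sub_sub_cancel] at h1
  rw [div_le_iff₀ hK, K_eq_moment]
  calc G = 2 / (σ * v * δ) * Real.exp E *
      (σ * (δ * (v / 2 * (G * Real.exp (-E))))) := by
        rw [Real.exp_neg]
        field_simp
    _ ≤ _ := by gcongr

lemma F_le (hσ : 0 < σ) (hw : Continuous w) {v m : ℝ} (hv : 0 ≤ v)
    (hm : ∀ u ∈ Set.Icc 0 v, |w u.toNNReal - u * w 1| ≤ m) (a : ℝ) :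
    F σ w v a ≤ v * Real.exp (σ * m + σ * v * |a|) := by
  have h : F σ w v a ≤ ∫ _ in (0 : ℝ)..v, Real.exp (σ * m + σ * v * |a|) := by
    refine intervalIntegral.integral_mono_on hv
      ((continuous_bridgeExp_left hw a).intervalIntegrable _ _)
      (continuous_const.intervalIntegrable _ _) fun u hu => ?_
    rw [bridgeExp_eq]
    refine Real.exp_le_exp.2 ?_
    have hu1 := hu.1
    have hu2 := hu.2
    have h2 := mul_le_mul_of_nonneg_left (abs_le.1 (hm u hu)).2 hσ.le
    have h3 : 0 ≤ σ ^ 2 * u / 2 := by positivity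
    have h4 : σ * u * a ≤ σ * v * |a| := by
      have := le_abs_self a
      calc σ * u * a ≤ σ * u * |a| := by gcongr
        _ ≤ _ := by gcongr
    linarith
  simpa using h

lemma densityIntegrand_nonneg (hσ : 0 < σ) {v : ℝ} (hv : 0 ≤ v) (z : ℝ) :
    0 ≤ densityIntegrand σ w v z := by
  unfold densityIntegrand
  refine div_nonneg (gaussianPDFReal_nonneg _ _ _) ?_
  rw [K_eq_moment]
  exact mul_nonneg hσ.le (moment_nonneg 1 hv _)

lemma gaussianPDFReal_le_exp (x : ℝ) : gaussianPDFReal 0 1 x ≤ Real.exp (-x ^ 2 / 2) := by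
  unfold gaussianPDFReal
  have h1 : (√(2 * Real.pi * ((1 : ℝ≥0) : ℝ)))⁻¹ ≤ 1 := by
    apply inv_le_one_of_one_le₀
    rw [Real.one_le_sqrt]
    have := Real.pi_gt_three
    simp only [NNReal.coe_one]
    linarith
  simpa using mul_le_mul_of_nonneg_right h1 (Real.exp_pos (-x ^ 2 / 2)).le

lemma densityIntegrand_le (hσ : 0 < σ) (hw : Continuous w) {v δ m : ℝ} (hδ : 0 < δ) (hδv : δ ≤ v)
    (hm : ∀ u ∈ Set.Icc 0 δ, |w u.toNNReal - u * w 1| ≤ m) (z : ℝ) :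
    densityIntegrand σ w v z ≤ 2 / (σ * δ ^ 2) *
      Real.exp (σ * m + σ ^ 2 * δ / 2 + σ * δ * |a σ w v z| - a σ w v z ^ 2 / 2) := by
  unfold densityIntegrand
  set x := a σ w v z
  have h1 := inv_K_le hσ hw hδ hδv hm x
  have h2 := gaussianPDFReal_le_exp x
  have hK := K_pos hσ hw (hδ.trans_le hδv) x
  calc gaussianPDFReal 0 1 x / K σ w v x
      = gaussianPDFReal 0 1 x * (K σ w v x)⁻¹ := div_eq_mul_inv _ _
    _ ≤ Real.exp (-x ^ 2 / 2) *
        (2 / (σ * δ ^ 2) * Real.exp (σ * m + σ ^ 2 * δ / 2 + σ * δ * |x|)) := by gcongr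
    _ = 2 / (σ * δ ^ 2) *
      Real.exp (σ * m + σ ^ 2 * δ / 2 + σ * δ * |x| - x ^ 2 / 2) := by
        rw [mul_left_comm, ← Real.exp_add]
        ring_nf

/-- Of the two factors $1/K$, one is paired with $G$ and bounded near $v$, the other is bounded near
$0$. Since the second moment is at most $v$ times the first, the last term of the bracket lies in
$[0,\sigma v]$. -/
lemma abs_densityDeriv_le (hσ : 0 < σ) (hw : Continuous w) {v δ m m' : ℝ} (hδ : 0 < δ)
    (hδv : δ ≤ v / 2)
    (hm : ∀ u ∈ Set.Icc 0 δ, |w u.toNNReal - u * w 1| ≤ m)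
    (hm' : ∀ u ∈ Set.Icc (v - δ) v,
      |(w v.toNNReal - v * w 1) - (w u.toNNReal - u * w 1)| ≤ m') (z : ℝ) :
    |densityDeriv σ w v z| ≤ 4 / (σ ^ 2 * v * δ ^ 3) * (|a σ w v z| + σ * v) *
      Real.exp (σ * m + σ * m' + σ ^ 2 * δ / 2 + 2 * (σ * δ * |a σ w v z|) -
        a σ w v z ^ 2 / 2) := by
  unfold densityDeriv
  set x := a σ w v z
  have hv : 0 < v := by linarith
  have h1 := inv_K_le hσ hw hδ (by linarith : δ ≤ v) hm x
  have h2 := bridgeExp_div_K_le hσ hw hδ hδv hm' x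
  have h3 := gaussianPDFReal_le_exp x
  have hK := K_pos hσ hw hv x
  have hG := bridgeExp_pos σ w v x
  have hφ := gaussianPDFReal_nonneg 0 1 x
  have h4 : 0 ≤ σ ^ 2 * moment σ w 2 v x / K σ w v x :=
    div_nonneg (mul_nonneg (sq_nonneg _) (moment_nonneg 2 hv.le x)) hK.le
  have h5 : σ ^ 2 * moment σ w 2 v x / K σ w v x ≤ σ * v := by
    rw [div_le_iff₀ hK, K_eq_moment]
    have := moment_succ_le (σ := σ) hw 1 hv.le x
    calc σ ^ 2 * moment σ w 2 v x ≤ σ ^ 2 * (v * moment σ w 1 v x) := by gcongr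
      _ = _ := by ring
  have h6 : |x - σ * v + σ ^ 2 * moment σ w 2 v x / K σ w v x| ≤ |x| + σ * v := by
    have := neg_abs_le x
    have := le_abs_self x
    have : 0 < σ * v := mul_pos hσ hv
    rw [abs_le]
    constructor <;> linarith
  rw [abs_mul]
  have e1 : |gaussianPDFReal 0 1 x * bridgeExp σ w v x / K σ w v x ^ 2| =
      gaussianPDFReal 0 1 x * (bridgeExp σ w v x / K σ w v x) * (K σ w v x)⁻¹ := by
    rw [abs_of_nonneg (by positivity)]
    field_simp
  rw [e1]
  calc gaussianPDFReal 0 1 x * (bridgeExp σ w v x / K σ w v x) * (K σ w v x)⁻¹ *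
      |x - σ * v + σ ^ 2 * moment σ w 2 v x / K σ w v x|
      ≤ Real.exp (-x ^ 2 / 2) * (2 / (σ * v * δ) * Real.exp (σ * m' + σ * δ * |x|)) *
        (2 / (σ * δ ^ 2) * Real.exp (σ * m + σ ^ 2 * δ / 2 + σ * δ * |x|)) *
        (|x| + σ * v) := by gcongr
    _ = 4 / (σ ^ 2 * v * δ ^ 3) * (|x| + σ * v) * (Real.exp (-x ^ 2 / 2) *
        Real.exp (σ * m' + σ * δ * |x|) *
        Real.exp (σ * m + σ ^ 2 * δ / 2 + σ * δ * |x|)) := by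
      field_simp
      ring
    _ = _ := by
      rw [← Real.exp_add, ← Real.exp_add]
      ring_nf

/-- Continuous paths, with the σ-algebra generated by the evaluations. -/
abbrev ContPath : Type := {w : ℝ≥0 → ℝ // Continuous w}

/-- Continuity in time upgrades measurability of each evaluation to joint measurability. -/
lemma measurable_eval_contPath :
    Measurable (fun p : ContPath × ℝ => p.1.1 p.2.toNNReal) := by
  have h : StronglyMeasurable (Function.uncurry fun (t : ℝ) (w : ContPath) => w.1 t.toNNReal) :=
    stronglyMeasurable_uncurry_of_continuous_of_stronglyMeasurable
      (fun w => w.2.comp continuous_real_toNNReal)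
      (fun t => ((measurable_pi_apply t.toNNReal).comp measurable_subtype_coe).stronglyMeasurable)
  exact h.measurable.comp measurable_swap

lemma measurable_moment (σ : ℝ) (k : ℕ) {v : ℝ} (hv : 0 ≤ v) :
    Measurable (fun p : ContPath × ℝ => moment σ p.1.1 k v p.2) := by
  unfold moment
  simp only [intervalIntegral.integral_of_le hv]
  have h1 : Measurable (fun q : (ContPath × ℝ) × ℝ => q.1.1.1 q.2.toNNReal) :=
    measurable_eval_contPath.comp (by fun_prop :
      Measurable fun q : (ContPath × ℝ) × ℝ => (q.1.1, q.2))
  have h2 : Measurable (fun q : (ContPath × ℝ) × ℝ => q.1.1.1 1) :=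
    ((measurable_pi_apply (1 : ℝ≥0)).comp measurable_subtype_coe).comp
      (measurable_fst.comp measurable_fst)
  have h3 : Measurable (fun q : (ContPath × ℝ) × ℝ =>
      q.2 ^ k * bridgeExp σ q.1.1.1 q.2 q.1.2) := by
    unfold bridgeExp
    fun_prop
  exact (h3.stronglyMeasurable.integral_prod_right
    (ν := volume.restrict (Set.Ioc 0 v))).measurable

/-- For $z>0$, monotonicity turns $a(v,z)<x$ into $z<F(v,x)$, a condition on measurable functions.
-/
lemma measurable_a (hσ : 0 < σ) {v : ℝ} (hv : 0 < v) :
    Measurable (fun p : ContPath × ℝ => a σ p.1.1 v p.2) := by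
  refine measurable_of_Iio fun x => ?_
  -- For $z\le0$ there is no solution, and `Function.invFun` returns a default value common to all
  -- paths.
  obtain ⟨c, hc⟩ : ∃ c : ℝ, ∀ (w : ContPath) (z : ℝ), z ≤ 0 → a σ w.1 v z = c := by
    refine ⟨Classical.arbitrary ℝ, fun w z hz => Function.invFun_neg ?_⟩
    rintro ⟨y, hy⟩
    have := F_pos (σ := σ) w.2 hv y
    linarith
  have hF : Measurable (fun p : ContPath × ℝ => F σ p.1.1 v x) := by
    simp only [F_eq_moment]
    exact (measurable_moment σ 0 hv.le).comp (measurable_fst.prodMk measurable_const)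
  have e : (fun p : ContPath × ℝ => a σ p.1.1 v p.2) ⁻¹' Set.Iio x =
      ({p | 0 < p.2} ∩ {p | p.2 < F σ p.1.1 v x}) ∪ ({p | p.2 ≤ 0} ∩ {_p | c < x}) := by
    ext p
    simp only [Set.mem_preimage, Set.mem_Iio, Set.mem_union, Set.mem_inter_iff, Set.mem_ofPred_eq]
    rcases le_or_gt p.2 0 with h | h
    · rw [hc p.1 p.2 h]
      simp [h, h.not_gt]
    · have := (strictMono_F hσ p.1.2 hv).lt_iff_lt (a := a σ p.1.1 v p.2) (b := x)
      rw [F_a hσ p.1.2 hv h] at this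
      simp [h, h.not_ge, this]
  rw [e]
  exact ((measurableSet_lt measurable_const measurable_snd).inter
    (measurableSet_lt measurable_snd hF)).union
    ((measurableSet_le measurable_snd measurable_const).inter (MeasurableSet.const _))

lemma measurable_moment_a (hσ : 0 < σ) (k : ℕ) {v : ℝ} (hv : 0 < v) :
    Measurable (fun p : ContPath × ℝ => moment σ p.1.1 k v (a σ p.1.1 v p.2)) :=
  (measurable_moment σ k hv.le).comp (measurable_fst.prodMk (measurable_a hσ hv))

lemma measurable_densityIntegrand (hσ : 0 < σ) {v : ℝ} (hv : 0 < v) :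
    Measurable (fun p : ContPath × ℝ => densityIntegrand σ p.1.1 v p.2) := by
  unfold densityIntegrand
  simp only [K_eq_moment]
  exact ((measurable_gaussianPDFReal 0 1).comp (measurable_a hσ hv)).div
    ((measurable_moment_a hσ 1 hv).const_mul σ)

lemma measurable_densityDeriv (hσ : 0 < σ) {v : ℝ} (hv : 0 < v) :
    Measurable (fun p : ContPath × ℝ => densityDeriv σ p.1.1 v p.2) := by
  have ha := measurable_a hσ hv
  have h1 := measurable_moment_a hσ 1 hv
  have h2 := measurable_moment_a hσ 2 hv
  have hφ := (measurable_gaussianPDFReal 0 1).comp ha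
  have hG : Measurable (fun p : ContPath × ℝ => bridgeExp σ p.1.1 v (a σ p.1.1 v p.2)) := by
    unfold bridgeExp
    have e1 : Measurable (fun p : ContPath × ℝ => p.1.1 v.toNNReal) :=
      ((measurable_pi_apply v.toNNReal).comp measurable_subtype_coe).comp measurable_fst
    have e2 : Measurable (fun p : ContPath × ℝ => p.1.1 1) :=
      ((measurable_pi_apply (1 : ℝ≥0)).comp measurable_subtype_coe).comp measurable_fst
    fun_prop
  unfold densityDeriv
  simp only [K_eq_moment, Function.comp_def] at *
  fun_prop

end Estimates

/-! ### Dyadic chaining for the Brownian maximum; a measurable continuous version -/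

section Chaining

/-- An odd point of level $n+1$ is one increment away from a point of level $n$, so the increments
add up to a geometric series; continuity passes from dyadic points to all $t$. -/
lemma abs_le_of_dyadic_increments {f : ℝ → ℝ} (hf : Continuous f) (h0 : f 0 = 0) {d r : ℝ}
    (hd : 0 ≤ d) (hr : 0 ≤ r) (hr1 : r < 1)
    (h : ∀ n k : ℕ, k < 2 ^ n → |f ((k + 1) / 2 ^ n) - f (k / 2 ^ n)| ≤ d * r ^ n)
    {t : ℝ} (ht : t ∈ Set.Icc (0 : ℝ) 1) : |f t| ≤ d * (1 - r)⁻¹ := by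
  have key : ∀ n k : ℕ, k ≤ 2 ^ n →
      |f (k / 2 ^ n)| ≤ d * ∑ j ∈ Finset.range (n + 1), r ^ j := by
    intro n
    induction n with
    | zero =>
      intro k hk
      have hk' : k = 0 ∨ k = 1 := by simp at hk; omega
      rcases hk' with rfl | rfl
      · simpa [h0] using hd
      · have := h 0 0 (by simp)
        simpa [h0] using this
    | succ n ih =>
      intro k hk
      rw [Finset.sum_range_succ, mul_add]
      have e : ∀ j : ℕ, ((2 * j : ℕ) : ℝ) / 2 ^ (n + 1) = j / 2 ^ n := by
        intro j
        push_cast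
        field_simp
        ring
      obtain ⟨j, hj | hj⟩ := k.even_or_odd'
      · subst hj
        rw [e]
        have h1 := ih j (by rw [pow_succ] at hk; omega)
        have : 0 ≤ d * r ^ (n + 1) := by positivity
        linarith
      · subst hj
        have hk2 : 2 * j < 2 ^ (n + 1) := by omega
        have h1 := ih j (by rw [pow_succ] at hk; omega)
        have h2 := h (n + 1) (2 * j) hk2
        rw [e] at h2
        push_cast at h2 ⊢
        have h3 := abs_sub_abs_le_abs_sub (f ((2 * (j : ℝ) + 1) / 2 ^ (n + 1))) (f (j / 2 ^ n))
        linarith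
  have hsum : ∀ n, ∑ j ∈ Finset.range n, r ^ j ≤ (1 - r)⁻¹ := fun n => by
    rw [← tsum_geometric_of_lt_one hr hr1]
    exact (summable_geometric_of_lt_one hr hr1).sum_le_tsum _ fun _ _ => pow_nonneg hr _
  have hlim : Tendsto (fun n : ℕ => ((⌊t * 2 ^ n⌋₊ : ℕ) : ℝ) / 2 ^ n) atTop (𝓝 t) :=
    (tendsto_nat_floor_mul_div_atTop ht.1).comp (tendsto_pow_atTop_atTop_of_one_lt one_lt_two)
  have hlim2 := ((hf.tendsto t).comp hlim).abs
  refine le_of_tendsto hlim2 (Eventually.of_forall fun n => ?_)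
  refine (key n _ ?_).trans (mul_le_mul_of_nonneg_left (hsum _) hd)
  have : t * 2 ^ n ≤ ((2 ^ n : ℕ) : ℝ) := by
    push_cast
    exact mul_le_of_le_one_left (by positivity) ht.2
  exact Nat.floor_le_of_le this

/-- Taking logarithms, an increment of level $n$ satisfies $D^2\le 4\cdot2^{-n}(2n+\log A)$, which
decays geometrically. The final constant is $256=4\cdot(1-7/8)^{-2}$. -/
lemma sq_le_log_of_dyadic_increments {f : ℝ → ℝ} (hf : Continuous f) (h0 : f 0 = 0) {A : ℝ}
    (hA : 1 ≤ A)
    (h : ∀ n k : ℕ, k < 2 ^ n →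
      (1 / 4) ^ n * Real.exp (2 ^ n / 4 * (f ((k + 1) / 2 ^ n) - f (k / 2 ^ n)) ^ 2) ≤ A)
    {t : ℝ} (ht : t ∈ Set.Icc (0 : ℝ) 1) : f t ^ 2 ≤ 256 * (4 + Real.log A) := by
  have hL : 0 ≤ Real.log A := Real.log_nonneg hA
  set L := Real.log A
  have hmain := abs_le_of_dyadic_increments hf h0 (d := √(4 * (4 + L))) (r := 7 / 8)
    (Real.sqrt_nonneg _) (by norm_num) (by norm_num) (fun n k hk => ?_) ht
  · have h1 : |f t| ^ 2 ≤ (√(4 * (4 + L)) * (1 - 7 / 8)⁻¹) ^ 2 := by gcongr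
    rw [sq_abs, mul_pow, Real.sq_sqrt (by positivity)] at h1
    norm_num at h1
    linarith
  · set D := f ((k + 1) / 2 ^ n) - f (k / 2 ^ n)
    have h1 := Real.log_le_log (by positivity) (h n k hk)
    rw [Real.log_mul (by positivity) (Real.exp_ne_zero _), Real.log_exp, Real.log_pow, one_div,
      Real.log_inv, show (4 : ℝ) = 2 ^ 2 by norm_num, Real.log_pow] at h1
    have h2 := Real.log_two_lt_d9
    have hn : (0 : ℝ) ≤ n := Nat.cast_nonneg n
    have h3 : 2 ^ n / 4 * D ^ 2 ≤ 2 * n + L := by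
      have : (n : ℝ) * Real.log 2 ≤ n * 1 := by gcongr; linarith
      norm_num at h1
      linarith
    -- Bernoulli absorbs the linear growth in $n$. The base satisfies $(49/32)/2=(7/8)^2$, which
    -- gives the ratio $7/8$; the summand $4$ makes $4\cdot\frac{17}{32}\ge2$.
    have h4 : 2 * n + L ≤ (49 / 32) ^ n * (4 + L) := by
      have h5 := one_add_mul_le_pow (show (-2 : ℝ) ≤ 17 / 32 by norm_num) n
      norm_num at h5
      have h6 : L ≤ (1 + n * (17 / 32)) * L := le_mul_of_one_le_left hL (by linarith)
      have h7 : (1 + n * (17 / 32)) * (4 + L) ≤ (49 / 32) ^ n * (4 + L) := by gcongr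
      linarith
    have h8 : D ^ 2 ≤ ((7 / 8) ^ n) ^ 2 * (4 * (4 + L)) := by
      have h9 : D ^ 2 = 4 / 2 ^ n * (2 ^ n / 4 * D ^ 2) := by field_simp
      rw [h9]
      calc 4 / 2 ^ n * (2 ^ n / 4 * D ^ 2) ≤ 4 / 2 ^ n * ((49 / 32) ^ n * (4 + L)) := by
            exact mul_le_mul_of_nonneg_left (h3.trans h4) (by positivity)
        _ = ((49 / 32) / 2) ^ n * (4 * (4 + L)) := by rw [div_pow (49 / 32 : ℝ) 2]; ring
        _ = _ := by
          rw [← pow_mul, mul_comm n 2, pow_mul]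
          norm_num
    have h10 := Real.abs_le_sqrt h8
    rw [Real.sqrt_mul (by positivity), Real.sqrt_sq (by positivity)] at h10
    linarith

/-- The weight $e^{x^2/(4v)}$ turns the density of variance $v$ into $\sqrt2$ times the density of
variance $2v$. -/
lemma lintegral_exp_sq_gaussianReal {v : ℝ≥0} (hv : v ≠ 0) :
    ∫⁻ x, ENNReal.ofReal (Real.exp (x ^ 2 / (4 * v))) ∂(gaussianReal 0 v) =
      ENNReal.ofReal (√2) := by
  have hv' : (0 : ℝ) < v := by positivity
  rw [gaussianReal_of_var_ne_zero 0 hv, lintegral_withDensity_eq_lintegral_mul _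
    (measurable_gaussianPDF 0 v) (by fun_prop)]
  have h : ∀ x, (gaussianPDF 0 v * fun x => ENNReal.ofReal (Real.exp (x ^ 2 / (4 * v)))) x =
      ENNReal.ofReal (√2) * gaussianPDF 0 (2 * v) x := by
    intro x
    simp only [Pi.mul_apply, gaussianPDF]
    rw [← ENNReal.ofReal_mul (gaussianPDFReal_nonneg _ _ _), ← ENNReal.ofReal_mul (by positivity)]
    congr 1
    unfold gaussianPDFReal
    rw [mul_assoc, ← Real.exp_add]
    have e1 : √(2 * Real.pi * ((2 * v : ℝ≥0) : ℝ)) = √2 * √(2 * Real.pi * v) := by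
      rw [← Real.sqrt_mul (by norm_num)]
      push_cast
      ring_nf
    have e2 : -(x - 0) ^ 2 / (2 * (v : ℝ)) + x ^ 2 / (4 * v) =
        -(x - 0) ^ 2 / (2 * ((2 * v : ℝ≥0) : ℝ)) := by
      push_cast
      field_simp
      ring
    rw [e1, e2, mul_inv]
    field_simp
  simp_rw [h]
  rw [lintegral_const_mul _ (measurable_gaussianPDF _ _),
    lintegral_gaussianPDF_eq_one 0 (by positivity), mul_one]

variable {Ω : Type*} [MeasurableSpace Ω] {P : Measure Ω} {W : ℝ≥0 → Ω → ℝ}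

lemma exists_sq_le_log_unit (hW : IsBrownianReal W P) [IsProbabilityMeasure P] :
    ∃ A : Ω → ℝ, Integrable A P ∧ ∫ ω, A ω ∂P ≤ 4 * Real.exp 4 ∧
      ∀ᵐ ω ∂P, 1 ≤ A ω ∧ ∀ t ∈ Set.Icc (0 : ℝ) 1,
        W t.toNNReal ω ^ 2 ≤ 256 * Real.log (A ω) := by
  let g : ℕ → ℕ → Ω → ℝ := fun n k ω => (1 / 4) ^ n * Real.exp (2 ^ n / 4 *
    (W ((k + 1) / 2 ^ n) ω - W (k / 2 ^ n) ω) ^ 2)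
  -- Each exponential has mean $\sqrt2$; level $n$ has $2^n$ of them with weight $4^{-n}$, so
  -- $\mathbf E S=2\sqrt2\le4$.
  let S : Ω → ENNReal := fun ω => ∑' n, ∑ k ∈ Finset.range (2 ^ n), ENNReal.ofReal (g n k ω)
  have hgm : ∀ n k, AEMeasurable (fun ω => ENNReal.ofReal (g n k ω)) P := by
    intro n k
    have h1 := hW.aemeasurable ((k + 1) / 2 ^ n)
    have h2 := hW.aemeasurable (k / 2 ^ n)
    exact ((((h1.sub h2).pow_const 2).const_mul _).exp.const_mul _).ennreal_ofReal
  have hSm : AEMeasurable S P :=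
    AEMeasurable.tsum fun n => Finset.aemeasurable_fun_sum _ fun k _ => hgm n k
  have hgi : ∀ n k, ∫⁻ ω, ENNReal.ofReal (g n k ω) ∂P = ENNReal.ofReal ((1 / 4) ^ n * √2) := by
    intro n k
    have hl := hW.hasLaw_sub ((k + 1) / 2 ^ n) (k / 2 ^ n)
    have hd : nndist ((k + 1) / 2 ^ n : ℝ≥0).1 (k / 2 ^ n : ℝ≥0).1 =
        ((1 / 2 ^ n : ℝ≥0)) := by
      ext
      rw [coe_nndist, Real.dist_eq]
      simp only [NNReal.val_eq_coe]
      push_cast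
      rw [← sub_div, add_sub_cancel_left, abs_of_pos (by positivity)]
    rw [hd] at hl
    have h3 := lintegral_exp_sq_gaussianReal (v := (1 / 2 ^ n : ℝ≥0)) (by positivity)
    rw [← hl.map_eq, lintegral_map' (by fun_prop) hl.aemeasurable] at h3
    rw [ENNReal.ofReal_mul (by positivity), ← h3, ← lintegral_const_mul'']
    · refine lintegral_congr fun ω => ?_
      rw [← ENNReal.ofReal_mul (by positivity)]
      simp only [g, Pi.sub_apply]
      congr 3
      push_cast
      field_simp
    · have h1 := hl.aemeasurable
      exact ((h1.pow_const 2).div_const _).exp.ennreal_ofReal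
  have hSi : ∫⁻ ω, S ω ∂P ≤ ENNReal.ofReal 4 := by
    have hs : Summable (fun n : ℕ => (1 / 2 : ℝ) ^ n * √2) :=
      (summable_geometric_of_lt_one (by norm_num) (by norm_num)).mul_right _
    rw [lintegral_tsum fun n => Finset.aemeasurable_fun_sum _ fun k _ => hgm n k]
    have : ∀ n : ℕ, ∫⁻ ω, ∑ k ∈ Finset.range (2 ^ n), ENNReal.ofReal (g n k ω) ∂P =
        ENNReal.ofReal ((1 / 2) ^ n * √2) := by
      intro n
      rw [lintegral_finsetSum' _ fun k _ => hgm n k]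
      simp_rw [hgi]
      rw [Finset.sum_const, Finset.card_range, nsmul_eq_mul, ← ENNReal.ofReal_natCast,
        ← ENNReal.ofReal_mul (by positivity), ← mul_assoc]
      congr 2
      push_cast
      rw [← mul_pow]
      norm_num
    simp_rw [this]
    rw [← ENNReal.ofReal_tsum_of_nonneg (fun n => by positivity) hs, tsum_mul_right,
      tsum_geometric_of_lt_one (by norm_num) (by norm_num)]
    refine ENNReal.ofReal_le_ofReal ?_
    have : √2 ≤ 2 := by rw [Real.sqrt_le_left (by norm_num)]; norm_num
    norm_num
    linarith
  have hfin : ∫⁻ ω, S ω ∂P ≠ ⊤ := ne_top_of_le_ne_top ENNReal.ofReal_ne_top hSi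
  -- The factor $e^4$ absorbs the additive $4$: $4+\log S=\log(e^4S)$.
  refine ⟨fun ω => Real.exp 4 * (S ω).toReal,
    (integrable_toReal_of_lintegral_ne_top hSm hfin).const_mul _, ?_, ?_⟩
  · rw [integral_const_mul, integral_toReal hSm (ae_lt_top' hSm hfin), mul_comm]
    gcongr
    exact ENNReal.toReal_le_of_le_ofReal (by norm_num) hSi
  · filter_upwards [hW.cont, hW.eval_zero_ae_eq_zero, ae_lt_top' hSm hfin] with ω hc h0 hlt
    have hle : ∀ n k : ℕ, k < 2 ^ n → g n k ω ≤ (S ω).toReal := by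
      intro n k hk
      rw [← ENNReal.ofReal_le_iff_le_toReal hlt.ne]
      exact (Finset.single_le_sum (f := fun k => ENNReal.ofReal (g n k ω))
        (fun _ _ => zero_le) (Finset.mem_range.2 hk)).trans
        (ENNReal.le_tsum (f := fun n => ∑ k ∈ Finset.range (2 ^ n), ENNReal.ofReal (g n k ω)) n)
    have hS1 : 1 ≤ (S ω).toReal := by
      refine le_trans ?_ (hle 0 0 (by norm_num))
      simp only [g, pow_zero, one_mul]
      exact Real.one_le_exp (by positivity)
    refine ⟨?_, fun t ht => ?_⟩
    · have := Real.one_le_exp (show (0 : ℝ) ≤ 4 by norm_num)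
      nlinarith
    · rw [Real.log_mul (Real.exp_ne_zero _) (by linarith), Real.log_exp]
      refine sq_le_log_of_dyadic_increments (f := fun t => W t.toNNReal ω)
        (hc.comp continuous_real_toNNReal) (by simpa using h0) hS1 (fun n k hk => ?_) ht
      have e1 : ((k : ℝ) / 2 ^ n).toNNReal = k / 2 ^ n := by
        rw [← NNReal.coe_inj, Real.coe_toNNReal _ (by positivity)]
        push_cast
        rfl
      have e2 : (((k : ℝ) + 1) / 2 ^ n).toNNReal = (k + 1) / 2 ^ n := by
        rw [← NNReal.coe_inj, Real.coe_toNNReal _ (by positivity)]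
        push_cast
        rfl
      rw [e1, e2]
      exact hle n k hk

/-- Shifting by $s$ and Brownian scaling by $t-s$ reduce this to the unit interval. -/
lemma exists_sq_increment_le_log (hW : IsBrownianReal W P) [IsProbabilityMeasure P] {s t : ℝ}
    (hs : 0 ≤ s) (hst : s < t) :
    ∃ A : Ω → ℝ, Integrable A P ∧ ∫ ω, A ω ∂P ≤ 4 * Real.exp 4 ∧
      ∀ᵐ ω ∂P, 1 ≤ A ω ∧ ∀ u ∈ Set.Icc s t,
        (W u.toNNReal ω - W s.toNNReal ω) ^ 2 ≤ 256 * (t - s) * Real.log (A ω) := by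
  have hc : 0 < t - s := sub_pos.2 hst
  have hB := (hW.shift s.toNNReal).smul (c := (t - s).toNNReal) (by simpa using hc)
  obtain ⟨A, hA, hA1, hA2⟩ := exists_sq_le_log_unit hB
  refine ⟨A, hA, hA1, ?_⟩
  filter_upwards [hA2] with ω hω
  refine ⟨hω.1, fun u hu => ?_⟩
  have hu1 : 0 ≤ u - s := sub_nonneg.2 hu.1
  have h := hω.2 ((u - s) / (t - s)) ⟨by positivity, by
    rw [div_le_one hc]; linarith [hu.2]⟩
  have e : s.toNNReal + (t - s).toNNReal * ((u - s) / (t - s)).toNNReal = u.toNNReal := by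
    rw [← NNReal.coe_inj]
    push_cast
    rw [Real.coe_toNNReal _ hs, Real.coe_toNNReal _ hc.le, Real.coe_toNNReal _ (by positivity),
      Real.coe_toNNReal _ (by linarith), mul_div_cancel₀ _ hc.ne']
    ring
  rw [e, mul_pow, inv_pow, Real.coe_toNNReal _ hc.le, Real.sq_sqrt hc.le] at h
  rw [inv_mul_le_iff₀ hc] at h
  linarith

/-- The process is only almost surely continuous and has almost everywhere measurable marginals. It
is set to zero off a good event determined by a dense sequence of times; limits then give
measurability at all times. -/
lemma exists_contPath_version (hW : IsBrownianReal W P) :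
    ∃ V : Ω → ContPath, Measurable V ∧ ∀ᵐ ω ∂P, (fun t => W t ω) = (V ω).1 := by
  let d := TopologicalSpace.denseSeq ℝ≥0
  have hgood : ∀ᵐ ω ∂P, Continuous (W · ω) ∧
      ∀ n, W (d n) ω = (hW.aemeasurable (d n)).mk _ ω :=
    hW.cont.and (ae_all_iff.2 fun n => (hW.aemeasurable (d n)).ae_eq_mk)
  obtain ⟨N, hN, hNm, hN0⟩ := exists_measurable_superset_of_null (ae_iff.1 hgood)
  have hS : ∀ ω ∉ N, Continuous (W · ω) ∧
      ∀ n, W (d n) ω = (hW.aemeasurable (d n)).mk _ ω := fun ω hω => by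
    by_contra hcon
    exact hω (hN hcon)
  classical
  let V : Ω → ContPath := fun ω =>
    if h : ω ∉ N then ⟨fun t => W t ω, (hS ω h).1⟩ else ⟨fun _ => 0, continuous_const⟩
  have hVd : ∀ n, Measurable (fun ω => (V ω).1 (d n)) := by
    intro n
    have : (fun ω => (V ω).1 (d n)) =
        fun ω => if ω ∈ N then 0 else (hW.aemeasurable (d n)).mk _ ω := by
      ext ω
      by_cases h : ω ∈ N
      · simp [V, h]
      · simp [V, h, (hS ω h).2 n]
    rw [this]
    exact Measurable.ite hNm measurable_const (hW.aemeasurable (d n)).measurable_mk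
  refine ⟨V, ?_, ?_⟩
  · refine Measurable.subtype_mk (f := fun ω => (V ω).1) (measurable_pi_lambda _ fun t => ?_)
    obtain ⟨x, hx, hxt⟩ := mem_closure_iff_seq_limit.1
      (TopologicalSpace.denseRange_denseSeq ℝ≥0 t)
    choose φ hφ using hx
    refine measurable_of_tendsto_metrizable (f := fun n ω => (V ω).1 (x n)) (fun n => ?_)
      (tendsto_pi_nhds.2 fun ω => ((V ω).2.tendsto t).comp hxt)
    rw [← hφ n]
    exact hVd (φ n)
  · have : ∀ᵐ ω ∂P, ω ∉ N := measure_eq_zero_iff_ae_notMem.1 hN0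
    filter_upwards [this] with ω hω
    simp [V, hω]

end Chaining

/-! ### Independence of the bridge and $W_1$; identification of the density -/

section Law

variable {σ : ℝ}

/-- The Brownian bridge on `[0, 1]` built from a path, frozen after time `1`. -/
def bridgePath (w : ContPath) : ContPath :=
  ⟨fun t => w.1 (min t 1) - (min t 1 : ℝ≥0) * w.1 1, by
    have := w.2
    fun_prop⟩

lemma measurable_eval (t : ℝ≥0) : Measurable (fun w : ContPath => w.1 t) :=
  (measurable_pi_apply t).comp measurable_subtype_coe

lemma measurable_bridgePath : Measurable bridgePath :=
  Measurable.subtype_mk (f := fun w : ContPath => (bridgePath w).1)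
    (measurable_pi_lambda _ fun _ => (measurable_eval _).sub ((measurable_eval 1).const_mul _))

lemma bridgeExp_bridgePath (w : ContPath) {u : ℝ} (hu : u ∈ Set.Icc (0 : ℝ) 1) (a : ℝ) :
    bridgeExp σ (bridgePath w).1 u a = bridgeExp σ w.1 u a := by
  rw [bridgeExp_eq, bridgeExp_eq]
  simp [bridgePath, hu.1, hu.2]

lemma moment_bridgePath (w : ContPath) (k : ℕ) {v : ℝ} (hv : v ∈ Set.Icc (0 : ℝ) 1) (a : ℝ) :
    moment σ (bridgePath w).1 k v a = moment σ w.1 k v a := by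
  refine intervalIntegral.integral_congr fun u hu => ?_
  rw [Set.uIcc_of_le hv.1] at hu
  simp only [bridgeExp_bridgePath w ⟨hu.1, hu.2.trans hv.2⟩]

lemma F_bridgePath (w : ContPath) {v : ℝ} (hv : v ∈ Set.Icc (0 : ℝ) 1) :
    F σ (bridgePath w).1 v = F σ w.1 v := by
  ext a
  rw [F_eq_moment, F_eq_moment, moment_bridgePath w 0 hv]

lemma densityIntegrand_bridgePath (w : ContPath) {v : ℝ} (hv : v ∈ Set.Icc (0 : ℝ) 1) (z : ℝ) :
    densityIntegrand σ (bridgePath w).1 v z = densityIntegrand σ w.1 v z := by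
  unfold densityIntegrand a
  simp only [F_bridgePath w hv, K_eq_moment, moment_bridgePath w 1 hv]

/-- Change of variables $z=F(v,x)$: the Jacobian $K$ cancels the denominator of the integrand. -/
lemma lintegral_gaussian_comp_F (hσ : 0 < σ) {w : ℝ≥0 → ℝ} (hw : Continuous w) {v : ℝ}
    (hv : 0 < v) {f : ℝ → ENNReal} (hf : Measurable f) :
    ∫⁻ x, f (F σ w v x) ∂(gaussianReal 0 1) =
      ∫⁻ z in Set.Ioi 0, ENNReal.ofReal (densityIntegrand σ w v z) * f z := by
  have hF : Continuous (F σ w v) :=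
    continuous_iff_continuousAt.2 fun a => (hasDerivAt_F hw v a).continuousAt
  have h := lintegral_image_eq_lintegral_abs_deriv_mul (s := Set.univ) MeasurableSet.univ
    (fun x _ => (hasDerivAt_F hw v x).hasDerivWithinAt) (strictMono_F hσ hw hv).injective.injOn
    (fun z => ENNReal.ofReal (densityIntegrand σ w v z) * f z)
  rw [Set.image_univ, range_F hσ hw hv, Measure.restrict_univ] at h
  have hfF : Measurable (fun x => f (F σ w v x)) := hf.comp hF.measurable
  rw [h, gaussianReal_of_var_ne_zero 0 one_ne_zero, lintegral_withDensity_eq_lintegral_mul _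
    (measurable_gaussianPDF 0 1) hfF]
  refine lintegral_congr fun x => ?_
  have hK := K_pos hσ hw hv x
  rw [Pi.mul_apply, ← mul_assoc, ← ENNReal.ofReal_mul (abs_nonneg _)]
  congr 1
  unfold densityIntegrand gaussianPDF
  rw [a_F hσ hw hv, abs_of_pos hK, mul_div_cancel₀ _ hK.ne']

lemma eta_eq_F {Ω : Type*} (w : ℝ≥0 → Ω → ℝ) (σ v : ℝ) (ω : Ω) :
    eta w σ v ω = F σ (fun t => w t ω) v (w 1 ω) := by
  unfold eta F bridgeExp
  congr with u
  ring_nf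

variable {Ω : Type*} [MeasurableSpace Ω] {P : Measure Ω} {V : Ω → ContPath}

/-- The bridge and $W_1$ are jointly Gaussian, and their covariance is $\min(t,1)-\min(t,1)=0$. -/
lemma indepFun_bridgePath (hV : Measurable V)
    (hB : IsBrownianReal (fun t ω => (V ω).1 t) P) :
    IndepFun (fun ω => bridgePath (V ω)) (fun ω => (V ω).1 1) P := by
  have hm : ∀ t : ℝ≥0, Measurable fun ω => (V ω).1 t := fun t => (measurable_eval t).comp hV
  have h : IndepFun (fun ω (t : ℝ≥0) => (bridgePath (V ω)).1 t)
      (fun ω (_ : Unit) => (V ω).1 1) P := by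
    refine IsGaussianProcess.indepFun_of_covariance_eq_zero
      (X := fun t ω => (bridgePath (V ω)).1 t) (Y := fun _ ω => (V ω).1 1) ?_
      (fun t => ((hm _).sub ((hm 1).const_mul _)).aemeasurable)
      (fun _ => (hm 1).aemeasurable) fun t _ => ?_
    · apply hB.isGaussianProcess.of_isGaussianProcess
      rintro (t | _)
      · exact ⟨{min t 1, 1},
          { toFun x := x ⟨min t 1, by simp⟩ - (min t 1 : ℝ≥0) * x ⟨1, by simp⟩
            map_add' x y := by simp; ring
            map_smul' c x := by simp; ring }, by simp [bridgePath]⟩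
      · exact ⟨{1},
          { toFun x := x ⟨1, by simp⟩
            map_add' x y := by simp
            map_smul' c x := by simp }, by simp⟩
    · have := hB.isGaussianProcess.isProbabilityMeasure
      have hL : ∀ t, MemLp (fun ω => (V ω).1 t) 2 P := fun t =>
        (hB.isGaussianProcess.hasGaussianLaw_eval t).memLp_two
      simp only [bridgePath]
      rw [covariance_fun_sub_left (hL _) ((hL 1).const_mul _) (hL 1),
        covariance_const_mul_left, hB.covariance_fun_eval, hB.covariance_fun_eval]
      simp
  have h2 : IndepFun (fun ω (t : ℝ≥0) => (bridgePath (V ω)).1 t) (fun ω => (V ω).1 1) P :=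
    h.comp measurable_id (measurable_pi_apply ())
  -- The σ-algebra of `ContPath` is pulled back from the product, so independence of coordinate
  -- families suffices.
  rw [IndepFun_iff_Indep] at h2 ⊢
  rwa [Subtype.instMeasurableSpace, MeasurableSpace.comap_comp]

lemma measurable_eta (hV : Measurable V) {v : ℝ} (hv : 0 ≤ v) :
    Measurable (eta (fun t ω => (V ω).1 t) σ v) := by
  have h1 : Measurable fun ω => (V ω).1 1 := (measurable_eval 1).comp hV
  have hm := (measurable_moment σ 0 hv).comp (hV.prodMk h1)
  convert hm using 1
  ext ω
  rw [eta_eq_F, F_eq_moment]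
  rfl

/-- Independence makes the joint law of bridge and $W_1$ a product; the inner Gaussian integral is
transformed for each frozen bridge, and Tonelli moves the bridge average inside the $z$-integral. -/
lemma map_eta_eq_withDensity (hσ : 0 < σ) (hV : Measurable V)
    (hB : IsBrownianReal (fun t ω => (V ω).1 t) P) {v : ℝ} (hv : v ∈ Set.Ioc (0 : ℝ) 1)
    (hI : ∀ z > 0, Integrable (fun ω => densityIntegrand σ (V ω).1 v z) P) :
    P.map (eta (fun t ω => (V ω).1 t) σ v) =
      (volume.restrict (Set.Ioi (0 : ℝ))).withDensity
        (fun z => ENNReal.ofReal (q P (fun t ω => (V ω).1 t) σ v z)) := by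
  have hprob := hB.isGaussianProcess.isProbabilityMeasure
  have hv' : v ∈ Set.Icc (0 : ℝ) 1 := ⟨hv.1.le, hv.2⟩
  set X : Ω → ContPath := fun ω => bridgePath (V ω) with hX
  have hXm : Measurable X := measurable_bridgePath.comp hV
  have hV1 : Measurable fun ω => (V ω).1 1 := (measurable_eval 1).comp hV
  have hprod := (indepFun_iff_map_prod_eq_prod_map_map hXm.aemeasurable hV1.aemeasurable).1
    (indepFun_bridgePath hV hB)
  have hlaw : P.map (fun ω => (V ω).1 1) = gaussianReal 0 1 := (hB.hasLaw_eval 1).map_eq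
  rw [hlaw] at hprod
  have hFm : Measurable (fun p : ContPath × ℝ => F σ p.1.1 v p.2) := by
    simp only [F_eq_moment]
    exact measurable_moment σ 0 hv.1.le
  have := Measure.isProbabilityMeasure_map hXm.aemeasurable (μ := P)
  ext s hs
  rw [withDensity_apply _ hs]
  set f : ℝ → ENNReal := s.indicator 1 with hf
  have hfm : Measurable f := measurable_one.indicator hs
  have hfF : Measurable (fun p : ContPath × ℝ => f (F σ p.1.1 v p.2)) := hfm.comp hFm
  have hdm := measurable_densityIntegrand hσ hv.1
  calc P.map (eta (fun t ω => (V ω).1 t) σ v) s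
      = ∫⁻ ω, f (eta (fun t ω => (V ω).1 t) σ v ω) ∂P := by
        rw [← lintegral_map hfm (measurable_eta hV hv.1.le), hf, lintegral_indicator_one hs]
    _ = ∫⁻ ω, f (F σ (X ω).1 v ((V ω).1 1)) ∂P := by
        refine lintegral_congr fun ω => ?_
        rw [eta_eq_F, hX, F_bridgePath _ hv']
    _ = ∫⁻ p, f (F σ p.1.1 v p.2) ∂((P.map X).prod (gaussianReal 0 1)) := by
        rw [← hprod, lintegral_map hfF (hXm.prodMk hV1)]
    _ = ∫⁻ b, (∫⁻ x, f (F σ b.1 v x) ∂(gaussianReal 0 1)) ∂(P.map X) :=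
        lintegral_prod _ hfF.aemeasurable
    _ = ∫⁻ b, (∫⁻ z in Set.Ioi 0, ENNReal.ofReal (densityIntegrand σ b.1 v z) * f z)
          ∂(P.map X) :=
        lintegral_congr fun b => lintegral_gaussian_comp_F hσ b.2 hv.1 hfm
    _ = ∫⁻ z in Set.Ioi 0, (∫⁻ b, ENNReal.ofReal (densityIntegrand σ b.1 v z) * f z
          ∂(P.map X)) :=
        lintegral_lintegral_swap
          (hdm.ennreal_ofReal.mul (hfm.comp measurable_snd)).aemeasurable
    _ = ∫⁻ z in Set.Ioi 0, ENNReal.ofReal (q P (fun t ω => (V ω).1 t) σ v z) * f z := by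
        refine setLIntegral_congr_fun measurableSet_Ioi fun z hz => ?_
        have hd : Measurable fun b : ContPath => ENNReal.ofReal (densityIntegrand σ b.1 v z) :=
          (hdm.comp (measurable_id.prodMk measurable_const)).ennreal_ofReal
        rw [lintegral_mul_const _ hd, lintegral_map hd hXm]
        congr 1
        unfold q
        rw [ofReal_integral_eq_lintegral_ofReal (hI z hz)
          (Eventually.of_forall fun ω => densityIntegrand_nonneg hσ hv.1.le z)]
        refine lintegral_congr fun ω => ?_
        rw [densityIntegrand_bridgePath _ hv']
    _ = ∫⁻ z in s, ENNReal.ofReal (q P (fun t ω => (V ω).1 t) σ v z)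
          ∂(volume.restrict (Set.Ioi 0)) := by
        rw [← lintegral_indicator hs]
        refine lintegral_congr fun z => ?_
        by_cases hz : z ∈ s <;> simp [hf, hz]

end Law

/-! ### Differentiation under the expectation -/

section Differentiation

variable {σ : ℝ} {w : ℝ≥0 → ℝ}

lemma abs_bridge_le {M : ℝ} (hM : ∀ u ∈ Set.Icc (0 : ℝ) 2, |w u.toNNReal| ≤ M)
    {u : ℝ} (hu : u ∈ Set.Icc (0 : ℝ) 2) : |w u.toNNReal - u * w 1| ≤ 3 * M := by
  have h1 := hM u hu
  have h2 := hM 1 (by norm_num)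
  rw [Real.toNNReal_one] at h2
  have h3 : |u * w 1| ≤ 2 * M := by
    rw [abs_mul, abs_of_nonneg hu.1]
    exact mul_le_mul hu.2 h2 (abs_nonneg _) (by norm_num)
  have h4 := abs_sub (w u.toNNReal) (u * w 1)
  linarith

/-- For $M^2=512\log A$ the first term is exactly $\log A$, so its exponential is the integrable
$A$. -/
lemma mul_le_sq_add (s M : ℝ) : s * M ≤ M ^ 2 / 512 + 128 * s ^ 2 := by
  nlinarith [sq_nonneg (M / 32 - 8 * s)]

/-- A bound for the density integrand along a path bounded by `√(512 log A)` on `[0, 2]`. -/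
lemma densityIntegrand_le_of_path_bound (hσ : 0 < σ) (hw : Continuous w) {v A : ℝ}
    (hv : v ∈ Set.Ioc (0 : ℝ) 1) (hA : 1 ≤ A)
    (hM : ∀ u ∈ Set.Icc (0 : ℝ) 2, w u.toNNReal ^ 2 ≤ 512 * Real.log A) (z : ℝ) :
    densityIntegrand σ w v z ≤ 2 / (σ * v ^ 2) *
      Real.exp (128 * (3 * σ) ^ 2 + σ ^ 2 * v / 2 + (σ * v) ^ 2 / 2) * A := by
  set M := √(512 * Real.log A)
  have hL : 0 ≤ Real.log A := Real.log_nonneg hA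
  have hM2 : M ^ 2 = 512 * Real.log A := Real.sq_sqrt (by positivity)
  have hb : ∀ u ∈ Set.Icc 0 v, |w u.toNNReal - u * w 1| ≤ 3 * M := fun u hu =>
    abs_bridge_le (fun s hs => Real.abs_le_sqrt (hM s hs)) ⟨hu.1, by linarith [hu.2, hv.2]⟩
  refine (densityIntegrand_le hσ hw hv.1 le_rfl hb z).trans ?_
  rw [mul_assoc (2 / (σ * v ^ 2)) _ A]
  refine mul_le_mul_of_nonneg_left ?_ (div_nonneg two_pos.le
    (mul_nonneg hσ.le (sq_nonneg v)))
  conv_rhs => rw [← Real.exp_log (by linarith : 0 < A)]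
  rw [← Real.exp_add]
  refine Real.exp_le_exp.2 ?_
  set x := a σ w v z
  have h1 := mul_le_sq_add (3 * σ) M
  have h2 : σ * v * |x| - x ^ 2 / 2 ≤ (σ * v) ^ 2 / 2 := by
    nlinarith [sq_nonneg (σ * v - |x|), sq_abs x]
  rw [hM2] at h1
  linarith

/-- A locally uniform bound for the derivative of the density integrand. -/
lemma abs_densityDeriv_le_of_path_bound (hσ : 0 < σ) (hw : Continuous w) {v₀ v A : ℝ}
    (hv₀ : 0 < v₀) (hv : v ∈ Set.Ioo (v₀ / 2) 2) (hA : 1 ≤ A)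
    (hM : ∀ u ∈ Set.Icc (0 : ℝ) 2, w u.toNNReal ^ 2 ≤ 512 * Real.log A) (z : ℝ) :
    |densityDeriv σ w v z| ≤ 4 / (σ ^ 2 * (v₀ / 2) * (v₀ / 4) ^ 3) * (1 + 2 * σ) *
      Real.exp (128 * (9 * σ) ^ 2 + σ ^ 2 * (v₀ / 4) / 2 + (1 + 2 * (σ * (v₀ / 4))) ^ 2 / 2) *
        A := by
  -- One $\delta$ serves the whole neighbourhood: $v>v_0/2$ gives $\delta\le v/2$.
  set δ := v₀ / 4 with hδ
  have hδ0 : 0 < δ := by positivity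
  set M := √(512 * Real.log A)
  have hL : 0 ≤ Real.log A := Real.log_nonneg hA
  have hM2 : M ^ 2 = 512 * Real.log A := Real.sq_sqrt (by positivity)
  have hb : ∀ u ∈ Set.Icc (0 : ℝ) 2, |w u.toNNReal - u * w 1| ≤ 3 * M := fun u hu =>
    abs_bridge_le (fun s hs => Real.abs_le_sqrt (hM s hs)) hu
  have hv1 := hv.1
  have hv2 := hv.2
  have hv0 : 0 < v := by linarith
  have h := abs_densityDeriv_le hσ hw (v := v) (δ := δ) (m := 3 * M) (m' := 6 * M) hδ0
    (by linarith) (fun u hu => hb u ⟨hu.1, by linarith [hu.2]⟩) (fun u hu => by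
      have h1 := hb v ⟨by linarith, by linarith⟩
      have h2 := hb u ⟨by linarith [hu.1], by linarith [hu.2]⟩
      have h3 := abs_sub (w v.toNNReal - v * w 1) (w u.toNNReal - u * w 1)
      linarith) z
  refine h.trans ?_
  set x := a σ w v z
  have hx := abs_nonneg x
  have h1 : |x| + σ * v ≤ (1 + 2 * σ) * Real.exp |x| := by
    have e1 := Real.add_one_le_exp |x|
    have e2 : σ * v ≤ σ * 2 := by gcongr
    nlinarith
  have h2 : σ * (3 * M) + σ * (6 * M) + σ ^ 2 * δ / 2 + 2 * (σ * δ * |x|) - x ^ 2 / 2 + |x| ≤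
      128 * (9 * σ) ^ 2 + σ ^ 2 * δ / 2 + (1 + 2 * (σ * δ)) ^ 2 / 2 + Real.log A := by
    have e1 := mul_le_sq_add (9 * σ) M
    have e2 : (1 + 2 * (σ * δ)) * |x| - x ^ 2 / 2 ≤ (1 + 2 * (σ * δ)) ^ 2 / 2 := by
      nlinarith [sq_nonneg (1 + 2 * (σ * δ) - |x|), sq_abs x]
    rw [hM2] at e1
    linarith
  calc 4 / (σ ^ 2 * v * δ ^ 3) * (|x| + σ * v) *
      Real.exp (σ * (3 * M) + σ * (6 * M) + σ ^ 2 * δ / 2 + 2 * (σ * δ * |x|) - x ^ 2 / 2)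
      ≤ 4 / (σ ^ 2 * (v₀ / 2) * δ ^ 3) * ((1 + 2 * σ) * Real.exp |x|) *
      Real.exp (σ * (3 * M) + σ * (6 * M) + σ ^ 2 * δ / 2 + 2 * (σ * δ * |x|) - x ^ 2 / 2) := by
        gcongr
    _ = 4 / (σ ^ 2 * (v₀ / 2) * δ ^ 3) * (1 + 2 * σ) * Real.exp
      (σ * (3 * M) + σ * (6 * M) + σ ^ 2 * δ / 2 + 2 * (σ * δ * |x|) - x ^ 2 / 2 + |x|) := by
        rw [Real.exp_add _ |x|]
        ring
    _ ≤ 4 / (σ ^ 2 * (v₀ / 2) * δ ^ 3) * (1 + 2 * σ) * Real.exp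
      (128 * (9 * σ) ^ 2 + σ ^ 2 * δ / 2 + (1 + 2 * (σ * δ)) ^ 2 / 2 + Real.log A) := by gcongr
    _ = _ := by
      rw [Real.exp_add _ (Real.log A), Real.exp_log (by linarith)]
      ring

variable {Ω : Type*} [MeasurableSpace Ω] {P : Measure Ω} [IsProbabilityMeasure P]
  {V : Ω → ContPath}

lemma exists_sq_le_log (hB : IsBrownianReal (fun t ω => (V ω).1 t) P) {t : ℝ} (ht : 0 < t) :
    ∃ A : Ω → ℝ, Integrable A P ∧ ∫ ω, A ω ∂P ≤ 4 * Real.exp 4 ∧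
      ∀ᵐ ω ∂P, 1 ≤ A ω ∧ ∀ u ∈ Set.Icc 0 t,
        (V ω).1 u.toNNReal ^ 2 ≤ 256 * t * Real.log (A ω) := by
  obtain ⟨A, h1, h2, h3⟩ := exists_sq_increment_le_log hB le_rfl ht
  refine ⟨A, h1, h2, ?_⟩
  filter_upwards [h3, hB.eval_zero_ae_eq_zero] with ω hω h0
  refine ⟨hω.1, fun u hu => ?_⟩
  have := hω.2 u hu
  rwa [Real.toNNReal_zero, h0, sub_zero, sub_zero] at this

lemma hasDerivAt_q (hσ : 0 < σ) (hV : Measurable V)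
    (hB : IsBrownianReal (fun t ω => (V ω).1 t) P) {v z : ℝ} (hv : v ∈ Set.Ioc (0 : ℝ) 1)
    (hz : 0 < z) :
    Integrable (fun ω => densityIntegrand σ (V ω).1 v z) P ∧
      HasDerivAt (fun u => q P (fun t ω => (V ω).1 t) σ u z)
        (∫ ω, densityDeriv σ (V ω).1 v z ∂P) v := by
  -- The path is controlled on $[0,2]$ so that $v=1$ also has a two-sided neighbourhood.
  obtain ⟨A, hA, -, hAb⟩ := exists_sq_le_log hB two_pos
  simp only [show (256 : ℝ) * 2 = 512 by norm_num] at hAb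
  have hv0 := hv.1
  have hm : ∀ x > 0, AEStronglyMeasurable (fun ω => densityIntegrand σ (V ω).1 x z) P :=
    fun x hx => ((measurable_densityIntegrand hσ hx).comp
      (hV.prodMk measurable_const)).aestronglyMeasurable
  have hint : Integrable (fun ω => densityIntegrand σ (V ω).1 v z) P := by
    refine (hA.const_mul (2 / (σ * v ^ 2) *
      Real.exp (128 * (3 * σ) ^ 2 + σ ^ 2 * v / 2 + (σ * v) ^ 2 / 2))).mono' (hm v hv0) ?_
    filter_upwards [hAb] with ω hω
    rw [Real.norm_eq_abs, abs_of_nonneg (densityIntegrand_nonneg hσ hv0.le z)]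
    exact densityIntegrand_le_of_path_bound hσ (V ω).2 hv hω.1 hω.2 z
  refine ⟨hint, ?_⟩
  refine (hasDerivAt_integral_of_dominated_loc_of_deriv_le (s := Set.Ioo (v / 2) 2)
    (F := fun x ω => densityIntegrand σ (V ω).1 x z)
    (F' := fun x ω => densityDeriv σ (V ω).1 x z)
    (bound := fun ω => 4 / (σ ^ 2 * (v / 2) * (v / 4) ^ 3) * (1 + 2 * σ) *
      Real.exp (128 * (9 * σ) ^ 2 + σ ^ 2 * (v / 4) / 2 + (1 + 2 * (σ * (v / 4))) ^ 2 / 2) * A ω)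
    (Ioo_mem_nhds (by linarith) (by linarith [hv.2])) ?_ hint ?_ ?_ (hA.const_mul _) ?_).2
  · filter_upwards [lt_mem_nhds hv0] with x hx using hm x hx
  · exact ((measurable_densityDeriv hσ hv0).comp
      (hV.prodMk measurable_const)).aestronglyMeasurable
  · filter_upwards [hAb] with ω hω x hx
    exact abs_densityDeriv_le_of_path_bound hσ (V ω).2 hv0 hx hω.1
      hω.2 z
  · refine Eventually.of_forall fun ω x hx => ?_
    exact hasDerivAt_densityIntegrand hσ (V ω).2 (by linarith [hx.1]) hz

end Differentiation

/-! ### The quantitative bound, uniform in $\sigma\ge\sigma_0$ -/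

section TailBound

variable {σ : ℝ} {w : ℝ≥0 → ℝ}

/-- Oscillation over an interval of length $\delta$ with $\sigma^2\delta\le1/2$ costs only a quarter
of $\log A$. -/
lemma mul_sqrt_le {s t L b : ℝ} (ht : 0 ≤ t) (hL : 0 ≤ L) (hst : s ^ 2 * t ≤ 1 / 2) :
    s * (b * √(t * L)) ≤ L / 4 + b ^ 2 / 2 := by
  rw [Real.sqrt_mul ht]
  have h1 := Real.sq_sqrt ht
  have h2 := Real.sq_sqrt hL
  have h3 : s * (b * (√t * √L)) ≤ √L ^ 2 / 4 + b ^ 2 * (s ^ 2 * √t ^ 2) := by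
    nlinarith [sq_nonneg (√L / 2 - b * (s * √t))]
  have h4 : b ^ 2 * (s ^ 2 * t) ≤ b ^ 2 * (1 / 2) := by gcongr
  rw [h1, h2] at h3
  linarith

lemma inv_mul_le_sq_div_add (r y : ℝ) :
    2 * (1 / (2 * r) * y) ≤ y ^ 2 / 2048 + 512 / r ^ 2 := by
  have e1 : 2 * (1 / (2 * r) * y) = r⁻¹ * y := by
    rw [one_div, mul_inv]
    ring
  rw [e1, div_eq_mul_inv 512, ← inv_pow]
  linarith [sq_nonneg (y / 64 - 16 * r⁻¹)]

lemma inv_mul_le_sq_div_add' (r y : ℝ) :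
    2 * (1 / (2 * r) * y) ≤ y ^ 2 / 16 + 8 / r ^ 2 := by
  have e1 : 2 * (1 / (2 * r) * y) = r⁻¹ * y := by
    rw [one_div, mul_inv]
    ring
  rw [e1, div_eq_mul_inv 8, ← inv_pow]
  linarith [sq_nonneg (y / 4 - 2 * r⁻¹), sq_nonneg r⁻¹]

/-- The geometric mean is at most the sum. Hence integrability of each variable suffices, with no
independence between them. -/
lemma exp_sum_log_div_four_le {A B C D : ℝ} (hA : 1 ≤ A) (hB : 1 ≤ B) (hC : 1 ≤ C) (hD : 1 ≤ D) :
    Real.exp ((Real.log A + Real.log B + Real.log C + Real.log D) / 4) ≤ A + B + C + D := by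
  have hS : 0 < A + B + C + D := by linarith
  have h1 := Real.log_le_log (by linarith) (by linarith : A ≤ A + B + C + D)
  have h2 := Real.log_le_log (by linarith) (by linarith : B ≤ A + B + C + D)
  have h3 := Real.log_le_log (by linarith) (by linarith : C ≤ A + B + C + D)
  have h4 := Real.log_le_log (by linarith) (by linarith : D ≤ A + B + C + D)
  rw [← Real.le_log_iff_exp_le hS]
  linarith

/-- The Gaussian exponent of the tail estimate, switched on for `z > v` only. -/
noncomputable def tailExponent (σ v z : ℝ) : ℝ :=
  if v < z then 1 / 6144 / (σ ^ 2 * v) * Real.log (z / v) ^ 2 else 0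

lemma exp_neg_tailExponent (σ v z : ℝ) :
    Real.exp (-tailExponent σ v z) = (if z ≤ v then 1 else 0) +
      Real.exp (-(1 / 6144 / (σ ^ 2 * v)) * Real.log (z / v) ^ 2) * (if v < z then 1 else 0) := by
  unfold tailExponent
  rcases le_or_gt z v with h | h
  · simp [h, h.not_gt]
  · simp [h, h.not_ge]

lemma tailExponent_le (hσ : 0 < σ) (hw : Continuous w) {v z L : ℝ} (hv : v ∈ Set.Ioc (0 : ℝ) 1)
    (hz : 0 < z) (hL : 0 ≤ L)
    (h : ∀ u ∈ Set.Icc 0 v, w u.toNNReal ^ 2 ≤ 256 * v * L) :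
    tailExponent σ v z ≤ L / 8 + w 1 ^ 2 / 2048 + a σ w v z ^ 2 / 2048 := by
  unfold tailExponent
  split_ifs with hvz
  swap
  · positivity
  have hv0 := hv.1
  have hv1 := hv.2
  set x := a σ w v z
  set y := |w 1| with hy
  have hy0 : 0 ≤ y := abs_nonneg _
  have hF := F_le hσ hw (v := v) (m := √(256 * v * L) + v * y) hv0.le (fun u hu => by
    have h1 := Real.abs_le_sqrt (h u hu)
    have h2 := abs_sub (w u.toNNReal) (u * w 1)
    have h3 : |u * w 1| ≤ v * y := by
      rw [abs_mul, abs_of_nonneg hu.1]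
      exact mul_le_mul_of_nonneg_right hu.2 hy0
    linarith) x
  rw [F_a hσ hw hv0 hz] at hF
  have hzv : 1 < z / v := (one_lt_div hv0).2 hvz
  have hlog0 : 0 < Real.log (z / v) := Real.log_pos hzv
  set r := √(256 * v * L) with hr
  have hr0 : 0 ≤ r := Real.sqrt_nonneg _
  have hr2 : r ^ 2 = 256 * v * L := Real.sq_sqrt (by positivity)
  have hlog : Real.log (z / v) ≤ σ * (r + v * y + v * |x|) := by
    rw [Real.log_le_iff_le_exp (by positivity), div_le_iff₀ hv0, mul_comm]
    refine hF.trans (le_of_eq ?_)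
    ring_nf
  have hsq : Real.log (z / v) ^ 2 ≤ (σ * (r + v * y + v * |x|)) ^ 2 := by gcongr
  have hy2 : y ^ 2 = w 1 ^ 2 := sq_abs _
  have hx2 : |x| ^ 2 = x ^ 2 := sq_abs _
  -- Here $768=3\cdot256$, and $v^2\le v$ uses $v\le1$. Division by $6144=3\cdot2048$ then leaves
  -- the weights $1/8$ and $1/2048$.
  have h3 : (r + v * y + v * |x|) ^ 2 ≤ v * (768 * L + 3 * w 1 ^ 2 + 3 * x ^ 2) := by
    have e1 : (r + v * y + v * |x|) ^ 2 ≤ 3 * (r ^ 2 + (v * y) ^ 2 + (v * |x|) ^ 2) := by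
      nlinarith [sq_nonneg (r - v * y), sq_nonneg (r - v * |x|), sq_nonneg (v * y - v * |x|)]
    have e2 : v ^ 2 * (w 1 ^ 2 + x ^ 2) ≤ v * (w 1 ^ 2 + x ^ 2) := by
      gcongr
      nlinarith
    rw [mul_pow, mul_pow, hy2, hx2, hr2] at e1
    linarith
  calc 1 / 6144 / (σ ^ 2 * v) * Real.log (z / v) ^ 2
      ≤ 1 / 6144 / (σ ^ 2 * v) * (σ ^ 2 * (v * (768 * L + 3 * w 1 ^ 2 + 3 * x ^ 2))) := by
        gcongr
        refine hsq.trans ?_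
        rw [mul_pow]
        gcongr
    _ = (768 * L + 3 * w 1 ^ 2 + 3 * x ^ 2) / 6144 := by field_simp
    _ = _ := by ring

/-- The constant in the pointwise estimate of the density derivative. -/
noncomputable def derivConst (σ₀ : ℝ) : ℝ :=
  32 * (1 + 1 / σ₀) * Real.exp (700 + 520 / σ₀ ^ 2)

lemma abs_densityDeriv_le_derivConst {σ₀ : ℝ} (hσ₀ : 0 < σ₀) (hσ : σ₀ ≤ σ) (hw : Continuous w)
    {v z δ L₀ L₁ L₂ L₃ : ℝ} (hv : v ∈ Set.Ioc (0 : ℝ) 1) (hz : 0 < z)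
    (hδ : δ = min (σ ^ 2 * v) 1 / (2 * σ ^ 2))
    (hL₀ : 0 ≤ L₀) (hL₁ : 0 ≤ L₁) (hL₂ : 0 ≤ L₂)
    (h₀ : ∀ u ∈ Set.Icc 0 δ, w u.toNNReal ^ 2 ≤ 256 * δ * L₀)
    (h₁ : ∀ u ∈ Set.Icc (v - δ) v,
      (w u.toNNReal - w (v - δ).toNNReal) ^ 2 ≤ 256 * (v - (v - δ)) * L₁)
    (h₂ : ∀ u ∈ Set.Icc 0 v, w u.toNNReal ^ 2 ≤ 256 * v * L₂)
    (h₃ : w 1 ^ 2 ≤ 256 * L₃) :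
    |densityDeriv σ w v z| ≤ derivConst σ₀ * σ ^ 7 / (min (σ ^ 2 * v) 1) ^ 4 *
      Real.exp (-tailExponent σ v z) * Real.exp ((L₀ + L₁ + L₂ + L₃) / 4) := by
  have hσ0 : 0 < σ := hσ₀.trans_le hσ
  have hv0 := hv.1
  have hv1 := hv.2
  set s := min (σ ^ 2 * v) 1 with hs
  have hs0 : 0 < s := lt_min (by positivity) one_pos
  have hsv : s ≤ σ ^ 2 * v := min_le_left _ _
  have hs1 : s ≤ 1 := min_le_right _ _
  have hδ0 : 0 < δ := by rw [hδ]; positivity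
  have hσδ : σ ^ 2 * δ = s / 2 := by rw [hδ]; field_simp
  have hδv : δ ≤ v / 2 := by
    rw [hδ, div_le_div_iff₀ (by positivity) two_pos]
    linarith
  have hσδ' : σ * δ ≤ 1 / (2 * σ₀) := by
    rw [le_div_iff₀ (by positivity)]
    calc σ * δ * (2 * σ₀) ≤ σ * δ * (2 * σ) := by gcongr
      _ = 2 * (σ ^ 2 * δ) := by ring
      _ ≤ 1 := by rw [hσδ]; linarith
  rw [sub_sub_cancel] at h₁
  set y := |w 1| with hy
  have hy0 : 0 ≤ y := abs_nonneg _
  have hy2 : y ^ 2 = w 1 ^ 2 := sq_abs _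
  -- The increment from $u$ to $v$ is a difference of two increments from $v-\delta$, hence
  -- $32=2\cdot16$.
  have key := abs_densityDeriv_le hσ0 hw (v := v) (δ := δ) (m := 16 * √(δ * L₀) + δ * y)
    (m' := 32 * √(δ * L₁) + δ * y) hδ0 hδv (fun u hu => by
      have e1 := Real.abs_le_sqrt (h₀ u hu)
      rw [mul_assoc, Real.sqrt_mul (by norm_num), show √(256 : ℝ) = 16 by
        rw [Real.sqrt_eq_iff_mul_self_eq] <;> norm_num] at e1
      have e2 := abs_sub (w u.toNNReal) (u * w 1)
      have e3 : |u * w 1| ≤ δ * y := by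
        rw [abs_mul, abs_of_nonneg hu.1]
        exact mul_le_mul_of_nonneg_right hu.2 hy0
      linarith) (fun u hu => by
      have e1 := Real.abs_le_sqrt (h₁ u hu)
      have e1' := Real.abs_le_sqrt (h₁ v ⟨by linarith, le_rfl⟩)
      rw [mul_assoc, Real.sqrt_mul (by norm_num), show √(256 : ℝ) = 16 by
        rw [Real.sqrt_eq_iff_mul_self_eq] <;> norm_num] at e1 e1'
      have e2 : |(v - u) * w 1| ≤ δ * y := by
        rw [abs_mul, abs_of_nonneg (by linarith [hu.2])]
        exact mul_le_mul_of_nonneg_right (by linarith [hu.1]) hy0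
      rw [abs_le] at e1 e1' e2 ⊢
      constructor <;> linarith) z
  refine key.trans ?_
  set x := a σ w v z
  have hx0 : 0 ≤ |x| := abs_nonneg x
  have hx2 : |x| ^ 2 = x ^ 2 := sq_abs x
  -- $\delta^{-3}=8\sigma^6/v_*^3$ and $\sigma^2v\ge v_*$. The seventh power of $\sigma$ comes from
  -- `hlin`.
  have hpre : 4 / (σ ^ 2 * v * δ ^ 3) ≤ 32 * σ ^ 6 / s ^ 4 := by
    rw [div_le_div_iff₀ (by positivity) (by positivity)]
    have e : δ ^ 3 * σ ^ 6 = s ^ 3 / 8 := by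
      calc δ ^ 3 * σ ^ 6 = (σ ^ 2 * δ) ^ 3 := by ring
        _ = _ := by rw [hσδ]; ring
    calc 4 * s ^ 4 = 4 * s * s ^ 3 := by ring
      _ ≤ 4 * (σ ^ 2 * v) * s ^ 3 := by gcongr
      _ = 32 * (σ ^ 2 * v) * (δ ^ 3 * σ ^ 6) := by rw [e]; ring
      _ = _ := by ring
  have hlin : |x| + σ * v ≤ σ * (1 + 1 / σ₀) * Real.exp |x| := by
    have e1 := Real.add_one_le_exp |x|
    have e2 : |x| ≤ σ * (1 / σ₀) * |x| := by
      refine le_mul_of_one_le_left hx0 ?_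
      rw [mul_one_div, one_le_div hσ₀]
      exact hσ
    have e3 : σ * v ≤ σ * 1 := by gcongr
    have e4 : 0 ≤ σ * (1 / σ₀) := by positivity
    calc |x| + σ * v ≤ σ * (1 + 1 / σ₀) * (|x| + 1) := by nlinarith [mul_nonneg hσ0.le hx0]
      _ ≤ _ := by gcongr
  have htail := tailExponent_le hσ0 hw hv hz hL₂ h₂
  -- The budget: the oscillations cost $L_0/4$ and $L_1/4$, and the tail exponent $L_2/8$. The two
  -- terms $W_1^2/2048$ cost $L_3/4$, and the terms in $a^2$ stay below $a^2/2$. The constants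
  -- $16^2/2+32^2/2+4+1/4$ are below $700$.
  have hexp : σ * (16 * √(δ * L₀) + δ * y) + σ * (32 * √(δ * L₁) + δ * y) + σ ^ 2 * δ / 2 +
      2 * (σ * δ * |x|) - x ^ 2 / 2 + |x| ≤
      700 + 520 / σ₀ ^ 2 + (L₀ + L₁ + L₂ + L₃) / 4 - tailExponent σ v z := by
    have hst : σ ^ 2 * δ ≤ 1 / 2 := by rw [hσδ]; linarith
    have e0 := mul_sqrt_le hδ0.le hL₀ hst (b := 16)
    have e1 := mul_sqrt_le hδ0.le hL₁ hst (b := 32)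
    have e2 : 2 * (σ * δ * y) ≤ w 1 ^ 2 / 2048 + 512 / σ₀ ^ 2 := by
      have e : σ * δ * y ≤ 1 / (2 * σ₀) * y := by gcongr
      have e' := inv_mul_le_sq_div_add σ₀ y
      rw [hy2] at e'
      linarith only [e, e']
    have e3 : 2 * (σ * δ * |x|) ≤ x ^ 2 / 16 + 8 / σ₀ ^ 2 := by
      have e : σ * δ * |x| ≤ 1 / (2 * σ₀) * |x| := by gcongr
      have e' := inv_mul_le_sq_div_add' σ₀ |x|
      rw [hx2] at e'
      linarith only [e, e']
    have e4 : |x| ≤ x ^ 2 / 16 + 4 := by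
      rw [← hx2]
      linarith only [sq_nonneg (|x| / 4 - 2)]
    have e5 : 520 / σ₀ ^ 2 = 512 / σ₀ ^ 2 + 8 / σ₀ ^ 2 := by ring
    have e6 := sq_nonneg x
    rw [e5]
    linarith only [e0, e1, e2, e3, e4, e6, hst, htail, h₃, hL₀, hL₁, hL₂]
  set T := tailExponent σ v z
  calc 4 / (σ ^ 2 * v * δ ^ 3) * (|x| + σ * v) *
      Real.exp (σ * (16 * √(δ * L₀) + δ * y) + σ * (32 * √(δ * L₁) + δ * y) + σ ^ 2 * δ / 2 +
        2 * (σ * δ * |x|) - x ^ 2 / 2)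
      ≤ 32 * σ ^ 6 / s ^ 4 * (σ * (1 + 1 / σ₀) * Real.exp |x|) *
      Real.exp (σ * (16 * √(δ * L₀) + δ * y) + σ * (32 * √(δ * L₁) + δ * y) + σ ^ 2 * δ / 2 +
        2 * (σ * δ * |x|) - x ^ 2 / 2) := by gcongr
    _ = 32 * σ ^ 6 / s ^ 4 * (σ * (1 + 1 / σ₀)) *
      Real.exp (σ * (16 * √(δ * L₀) + δ * y) + σ * (32 * √(δ * L₁) + δ * y) + σ ^ 2 * δ / 2 +
        2 * (σ * δ * |x|) - x ^ 2 / 2 + |x|) := by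
        rw [Real.exp_add _ |x|]
        ring
    _ ≤ 32 * σ ^ 6 / s ^ 4 * (σ * (1 + 1 / σ₀)) *
      Real.exp (700 + 520 / σ₀ ^ 2 + (L₀ + L₁ + L₂ + L₃) / 4 - T) := by gcongr
    _ = _ := by
      unfold derivConst
      rw [sub_eq_add_neg, Real.exp_add, Real.exp_add (700 + 520 / σ₀ ^ 2)]
      ring

variable {Ω : Type*} [MeasurableSpace Ω] {P : Measure Ω} [IsProbabilityMeasure P]
  {V : Ω → ContPath}

lemma abs_integral_densityDeriv_le {σ₀ : ℝ} (hσ₀ : 0 < σ₀) (hσ : σ₀ ≤ σ)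
    (hB : IsBrownianReal (fun t ω => (V ω).1 t) P) {v z : ℝ} (hv : v ∈ Set.Ioc (0 : ℝ) 1)
    (hz : 0 < z) :
    |∫ ω, densityDeriv σ (V ω).1 v z ∂P| ≤
      derivConst σ₀ * (16 * Real.exp 4) * σ ^ 7 / (min (σ ^ 2 * v) 1) ^ 4 *
        Real.exp (-tailExponent σ v z) := by
  have hσ0 : 0 < σ := hσ₀.trans_le hσ
  have hv0 := hv.1
  set δ := min (σ ^ 2 * v) 1 / (2 * σ ^ 2) with hδ
  have hs0 : 0 < min (σ ^ 2 * v) 1 := lt_min (by positivity) one_pos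
  have hδ0 : 0 < δ := by positivity
  have hδv : δ ≤ v / 2 := by
    rw [hδ, div_le_div_iff₀ (by positivity) two_pos]
    linarith [min_le_left (σ ^ 2 * v) 1]
  -- One variable each for the start $[0,\delta]$, the end $[v-\delta,v]$, the whole of $[0,v]$, and
  -- $W_1$. Four means of at most $4e^4$ give $16e^4$.
  obtain ⟨A₀, hA₀, hA₀', h₀⟩ := exists_sq_le_log hB hδ0
  obtain ⟨A₁, hA₁, hA₁', h₁⟩ := exists_sq_increment_le_log hB (s := v - δ) (t := v)
    (by linarith) (by linarith)
  obtain ⟨A₂, hA₂, hA₂', h₂⟩ := exists_sq_le_log hB hv0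
  obtain ⟨A₃, hA₃, hA₃', h₃⟩ := exists_sq_le_log hB one_pos
  have hc : 0 < derivConst σ₀ := by unfold derivConst; positivity
  set C := derivConst σ₀ * σ ^ 7 / (min (σ ^ 2 * v) 1) ^ 4 * Real.exp (-tailExponent σ v z)
    with hC
  have hC0 : 0 < C := by positivity
  have h01 : Integrable (fun ω => A₀ ω + A₁ ω) P := hA₀.add hA₁
  have h012 : Integrable (fun ω => A₀ ω + A₁ ω + A₂ ω) P := h01.add hA₂
  have hint : Integrable (fun ω => A₀ ω + A₁ ω + A₂ ω + A₃ ω) P := h012.add hA₃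
  have hle := norm_integral_le_of_norm_le (f := fun ω => densityDeriv σ (V ω).1 v z)
    (hint.const_mul C) (by
      filter_upwards [h₀, h₁, h₂, h₃] with ω g₀ g₁ g₂ g₃
      have e3 := g₃.2 1 (by norm_num)
      rw [Real.toNNReal_one, mul_one] at e3
      refine (abs_densityDeriv_le_derivConst hσ₀ hσ (V ω).2 hv hz hδ (Real.log_nonneg g₀.1)
        (Real.log_nonneg g₁.1) (Real.log_nonneg g₂.1) g₀.2 g₁.2 g₂.2 e3).trans ?_
      exact mul_le_mul_of_nonneg_left (exp_sum_log_div_four_le g₀.1 g₁.1 g₂.1 g₃.1) hC0.le)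
  rw [integral_const_mul, integral_add h012 hA₃, integral_add h01 hA₂,
    integral_add hA₀ hA₁] at hle
  calc |∫ ω, densityDeriv σ (V ω).1 v z ∂P|
      ≤ C * (∫ ω, A₀ ω ∂P + ∫ ω, A₁ ω ∂P + ∫ ω, A₂ ω ∂P + ∫ ω, A₃ ω ∂P) := hle
    _ ≤ C * (16 * Real.exp 4) := by
      gcongr
      linarith
    _ = _ := by rw [hC]; ring

end TailBound

end AsianDensity

theorem mainTheorem5 (σ₀ : ℝ) (hσ₀ : 0 < σ₀) :
    ∃ c > (0 : ℝ), ∃ κ > (0 : ℝ),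
      ∀ {Ω : Type*} [MeasurableSpace Ω] (P : Measure Ω) [IsProbabilityMeasure P]
        (W : ℝ≥0 → Ω → ℝ), IsBrownianReal W P →
      ∀ σ : ℝ, σ₀ ≤ σ → ∀ v ∈ Set.Ioc (0 : ℝ) 1,
        (AEMeasurable (AsianDensity.eta W σ v) P ∧
          P.map (AsianDensity.eta W σ v) =
            (volume.restrict (Set.Ioi (0 : ℝ))).withDensity
              (fun z => ENNReal.ofReal (AsianDensity.q P W σ v z))) ∧
        ∀ z > (0 : ℝ),
          Integrable (fun ω => AsianDensity.densityIntegrand σ (fun t => W t ω) v z) P ∧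
          ∃ qv : ℝ,
            HasDerivWithinAt (fun u => AsianDensity.q P W σ u z) qv (Set.Ioc (0 : ℝ) 1) v ∧
            |qv| ≤ c * σ ^ 7 / (min (σ ^ 2 * v) 1) ^ 4 *
              ((if z ≤ v then 1 else 0) +
                Real.exp (-(κ / (σ ^ 2 * v)) * (Real.log (z / v)) ^ 2) *
                  (if v < z then 1 else 0)) := by
  refine ⟨AsianDensity.derivConst σ₀ * (16 * Real.exp 4),
    by unfold AsianDensity.derivConst; positivity, 1 / 6144, by norm_num, ?_⟩
  intro Ω _ P _ W hW σ hσ v hv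
  have hσ0 : 0 < σ := hσ₀.trans_le hσ
  obtain ⟨V, hV, hWV⟩ := AsianDensity.exists_contPath_version hW
  have hB : IsBrownianReal (fun t ω => (V ω).1 t) P :=
    ⟨hW.toIsPreBrownianReal.congr fun t => by
      filter_upwards [hWV] with ω hω using congrFun hω t,
      Filter.Eventually.of_forall fun ω => (V ω).2⟩
  have hq : AsianDensity.q P W σ = AsianDensity.q P (fun t ω => (V ω).1 t) σ := by
    ext u z
    refine integral_congr_ae ?_
    filter_upwards [hWV] with ω hω
    rw [hω]
  have heta : AsianDensity.eta W σ v =ᵐ[P] AsianDensity.eta (fun t ω => (V ω).1 t) σ v := by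
    filter_upwards [hWV] with ω hω
    rw [AsianDensity.eta_eq_F, AsianDensity.eta_eq_F, hω, congrFun hω 1]
  refine ⟨⟨⟨_, AsianDensity.measurable_eta hV hv.1.le, heta⟩, ?_⟩, fun z hz => ⟨?_, ?_⟩⟩
  · rw [Measure.map_congr heta, hq]
    exact AsianDensity.map_eta_eq_withDensity hσ0 hV hB hv fun z hz =>
      (AsianDensity.hasDerivAt_q hσ0 hV hB hv hz).1
  · refine (AsianDensity.hasDerivAt_q hσ0 hV hB hv hz).1.congr ?_
    filter_upwards [hWV] with ω hω
    rw [hω]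
  · refine ⟨∫ ω, AsianDensity.densityDeriv σ (V ω).1 v z ∂P, ?_, ?_⟩
    · rw [hq]
      exact (AsianDensity.hasDerivAt_q hσ0 hV hB hv hz).2.hasDerivWithinAt
    · rw [← AsianDensity.exp_neg_tailExponent]
      exact AsianDensity.abs_integral_densityDeriv_le hσ₀ hσ hB hv hz
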